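/- Let $H\in(1/2,1)$, $T>0$, $\alpha_H=H(2H-1)$, let $V$ be a real Hilbert space with a complete orthonormal sequence $(e_k)_{k\ge1}$, and let $(\beta^k)_{k\ge1}$ be i.i.d. fractional Brownian motions of Hurst index $H$ on $[0,T]$, defined on a probability space $(\Omega,\mathcal F,P)$. *Spaces.* Let $\mathcal H_V$ be the completion of the $V$-valued elementary functions $\sum_i 1_{(t_{i-1},t_i]}\varphi_i$ on $[0,T]$ with respect to $\langle\phi,\psi\rangle_{\mathcal H_V}=\alpha_H\int_0^T\!\int_0^T\langle\phi(t),\psi(s)\rangle_V|t-s|^{2H-2}\,ds\,dt$, and let $\mathcal H=\mathcal H_{\mathbb R}$. For $v\in V$, $\phi\mapsto\phi v$ denotes the bounded linear map $\mathcal H\to\mathcal H_V$ that extends $\phi\mapsto\phi(\cdot)v$, and $\chi\mapsto\chi\,v\otimes v$ the bounded linear map $\mathcal H\otimes\mathcal H\to\mathcal H_V\otimes\mathcal H_V$ with $\phi\otimes\psi\mapsto(\phi v)\otimes(\psi v)$ (Hilbert space tensor products). *Gaussian processes.* Let $\beta^k(\phi)$, $\phi\in\mathcal H$, be the continuous linear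 extension of $1_{[0,t]}\mapsto\beta^k_t$ to a map $\mathcal H\to L_2(\Omega)$, and for $\varphi=\sum_k\phi^ke_k\in\mathcal H_V$ with $\phi^k\in\mathcal H$ let $B(\varphi)=\sum_k\beta^k(\phi^k)$ in $L_2(\Omega)$. *Malliavin calculus.* Let $W$ be one of the processes $\beta^k$, with $\mathcal K=\mathcal H$, or $B$, with $\mathcal K=\mathcal H_V$. For $F=f(W(\phi_1),\dots,W(\phi_n))$ with $\phi_i\in\mathcal K$ and $f:\mathbb R^n\to\mathbb R$ smooth and bounded together with all its partial derivatives, put $D^WF=\sum_i\partial_if(W(\phi_1),\dots,W(\phi_n))\phi_i$. For a Hilbert space $V'$ and finite sums $U=\sum_jF_j\varphi_j$ with such $F_j$ and $\varphi_j\in V'$, put $D^WU=\sum_jD^WF_j\otimes\varphi_j$. Let $\mathbb D^{1,2}_W$ and $\mathbb D^{1,2}_W(V')$ be the completions of the spaces of such $F$ and $U$ for $\|F\|^2=E|F|^2+E\|D^WF\|_{\mathcal K}^2$ and $\|U\|^2=E\|U\|_{V'}^2+E\|D^WU\|_{\mathcal K\otimes V'}^2$, to which $D^W$ extends. The Skorohod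 integral $\delta^W$ is the adjoint of $D^W$: $X=\delta^W(U)$, for $U\in L_2(\Omega;\mathcal K)$, is the random variable $X\in L_2(\Omega,\sigma(W),P)$ with $E(FX)=E\langle D^WF,U\rangle_{\mathcal K}$ for all $F\in\mathbb D^{1,2}_W$, and $U\in\operatorname{Dom}\delta^W$ means that it exists. **Theorem.** Let $u^k\in\mathbb D^{1,2}_{\beta^k}(\mathcal H)$ for all $k\ge1$, with $\sum_{k=1}^\infty\|u^k\|^2_{\mathbb D^{1,2}_{\beta^k}(\mathcal H)}<\infty$. Then: a) $U^{(N)}:=\sum_{k=1}^Nu^ke_k\in\mathbb D^{1,2}_B(\mathcal H_V)$ for all $N\ge1$, with $D^BU^{(N)}=\sum_{k=1}^N(D^{\beta^k}u^k)\,e_k\otimes e_k$, and there is $U=:\sum_{k=1}^\infty u^ke_k\in\mathbb D^{1,2}_B(\mathcal H_V)$ such that $\|U^{(N)}-U\|_{\mathbb D^{1,2}_B(\mathcal H_V)}\to0$ as $N\to\infty$. Moreover $D^BU=\sum_{k=1}^\infty(D^{\beta^k}u^k)\,e_k\otimes e_k$ in $L_2(\Omega;\mathcal H_V\otimes\mathcal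 H_V)$ and $$\|U\|^2_{\mathbb D^{1,2}_B(\mathcal H_V)}=\sum_{k=1}^\infty\|u^k\|^2_{\mathbb D^{1,2}_{\beta^k}(\mathcal H)}.$$ b) $u^k\in\operatorname{Dom}\delta^{\beta^k}$ for all $k$, $U\in\operatorname{Dom}\delta^B$, and $\sum_{k=1}^N\delta^{\beta^k}(u^k)\to\delta^B(U)$ in $L_2(\Omega)$ as $N\to\infty$, that is, $\delta^B(U)=\sum_{k=1}^\infty\delta^{\beta^k}(u^k)$ in $L_2(\Omega)$. -/

import Mathlib

open MeasureTheory ProbabilityTheory Filter Topology UniformSpace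
open scoped TensorProduct ENNReal

namespace FracMalliavin

/-- Hurst indices `1/2 < H < 1`. -/
abbrev HurstIndex : Type := Set.Ioo (1 / 2 : ℝ) 1

/-- The kernel `α_H |t - s|^(2H-2)`, where `α_H = H (2H-1)`. -/
noncomputable def fracKernel (H : HurstIndex) (t s : ℝ) : ℝ :=
  (H : ℝ) * (2 * (H : ℝ) - 1) * |t - s| ^ (2 * (H : ℝ) - 2)

section
variable {V : Type*} [NormedAddCommGroup V] [InnerProductSpace ℝ V]

/-- Elementary functions with values in `V`: the linear combinations of functions `1_{(a,b]} v`,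
`0 ≤ a ≤ b ≤ T`. -/
def elementary (T : ℝ) (V : Type*) [NormedAddCommGroup V] [InnerProductSpace ℝ V] :
    Submodule ℝ (ℝ → V) :=
  Submodule.span ℝ {f | ∃ (a b : ℝ) (v : V), 0 ≤ a ∧ a ≤ b ∧ b ≤ T ∧
    f = (Set.Ioc a b).indicator fun _ => v}

theorem elementary_stronglyMeasurable {T : ℝ} {φ : ℝ → V} (hφ : φ ∈ elementary T V) :
    StronglyMeasurable φ := by
  induction hφ using Submodule.span_induction with
  | mem x h =>
    obtain ⟨a, b, v, -, -, -, rfl⟩ := h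
    exact stronglyMeasurable_const.indicator measurableSet_Ioc
  | zero => exact stronglyMeasurable_zero
  | add x y _ _ hx hy => exact hx.add hy
  | smul c x _ hx => exact hx.const_smul c

theorem elementary_bounded {T : ℝ} {φ : ℝ → V} (hφ : φ ∈ elementary T V) :
    ∃ C : ℝ, 0 ≤ C ∧ ∀ t, ‖φ t‖ ≤ C := by
  induction hφ using Submodule.span_induction with
  | mem x h =>
    obtain ⟨a, b, v, -, -, -, rfl⟩ := h
    exact ⟨‖v‖, norm_nonneg _, fun t => norm_indicator_le_norm_self (fun _ => v) t⟩
  | zero => exact ⟨0, le_rfl, by simp⟩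
  | add x y _ _ hx hy =>
    obtain ⟨C, hC, h1⟩ := hx
    obtain ⟨D, hD, h2⟩ := hy
    exact ⟨C + D, by positivity, fun t => (norm_add_le _ _).trans (add_le_add (h1 t) (h2 t))⟩
  | smul c x _ hx =>
    obtain ⟨C, hC, h1⟩ := hx
    exact ⟨‖c‖ * C, by positivity, fun t => by
      simpa [norm_smul] using mul_le_mul_of_nonneg_left (h1 t) (abs_nonneg c)⟩

theorem smul_mem_elementary {T : ℝ} {φ : ℝ → ℝ} (hφ : φ ∈ elementary T ℝ) (v : V) :
    (fun t => φ t • v) ∈ elementary T V := by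
  induction hφ using Submodule.span_induction with
  | mem x h =>
    obtain ⟨a, b, c, ha, hab, hb, rfl⟩ := h
    refine Submodule.subset_span ⟨a, b, c • v, ha, hab, hb, ?_⟩
    funext t
    by_cases ht : t ∈ Set.Ioc a b <;> simp [ht]
  | zero =>
    convert Submodule.zero_mem (elementary T V) using 1
    funext t; simp
  | add x y _ _ hx hy =>
    have := Submodule.add_mem _ hx hy
    convert this using 1
    funext t; simp [add_smul]
  | smul c x _ hx =>
    have := Submodule.smul_mem _ c hx
    convert this using 1
    funext t; simp [mul_smul]

/-- Lebesgue measure on `[0, T]`. -/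
noncomputable def leb (T : ℝ) : Measure ℝ := volume.restrict (Set.Icc 0 T)

instance (T : ℝ) : IsFiniteMeasure (leb T) := by unfold leb; infer_instance

theorem integrableOn_abs_rpow {q : ℝ} (hq : -1 < q) (R : ℝ) :
    IntegrableOn (fun x : ℝ => |x| ^ q) (Set.Icc (-R) R) := by
  have h1 : IntegrableOn (fun x : ℝ => |x| ^ q) (Set.Ioc 0 R) := by
    by_cases hR : 0 ≤ R
    · have := (intervalIntegral.intervalIntegrable_rpow' (a := 0) (b := R) hq)
      rw [intervalIntegrable_iff_integrableOn_Ioc_of_le hR] at this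
      refine this.congr_fun (fun x hx => ?_) measurableSet_Ioc
      simp [abs_of_pos hx.1]
    · rw [Set.Ioc_eq_empty (by linarith)]; simp
  have h2 : IntegrableOn (fun x : ℝ => |x| ^ q) (Set.Icc 0 R) := by
    rwa [integrableOn_Icc_iff_integrableOn_Ioc]
  have h3 : IntegrableOn (fun x : ℝ => |x| ^ q) (Set.Icc (-R) 0) := by
    have := h2.comp_neg
    simpa using this
  exact (h3.union h2).mono_set (fun x hx => by
    rcases le_total x 0 with h | h
    · exact Or.inl ⟨hx.1, h⟩
    · exact Or.inr ⟨h, hx.2⟩)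

theorem integrable_abs_sub_rpow {q : ℝ} (hq : -1 < q) (T : ℝ) :
    Integrable (fun p : ℝ × ℝ => |p.1 - p.2| ^ q) ((leb T).prod (leb T)) := by
  have h0 : Integrable (fun x : ℝ => (Set.Icc (-T) T).indicator (fun x => |x| ^ q) x) :=
    (integrable_indicator_iff measurableSet_Icc).2 (integrableOn_abs_rpow hq T)
  have h1 : Integrable (fun p : ℝ × ℝ => (Set.Icc (-T) T).indicator (fun x => |x| ^ q) (p.1 - p.2))
      ((volume : Measure ℝ).prod (leb T)) := by
    have h2 : Integrable (fun p : ℝ × ℝ => (Set.Icc (-T) T).indicator (fun x => |x| ^ q) p.1)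
      ((volume : Measure ℝ).prod (leb T)) := h0.comp_fst (leb T)
    have h3 : MeasurePreserving (fun p : ℝ × ℝ => (p.1 - p.2, p.2))
      ((volume : Measure ℝ).prod (leb T)) ((volume : Measure ℝ).prod (leb T)) := by
      have := (measurePreserving_sub_prod (volume : Measure ℝ) (leb T))
      exact this
    exact h3.integrable_comp_of_integrable h2
  have h4 : ((leb T).prod (leb T)) = (((volume : Measure ℝ).prod (leb T))).restrict
      (Set.Icc 0 T ×ˢ Set.Icc 0 T) := by
    rw [leb, ← Measure.prod_restrict, Measure.restrict_restrict measurableSet_Icc, Set.inter_self]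
  rw [h4]
  refine (h1.integrableOn (s := Set.Icc 0 T ×ˢ Set.Icc 0 T)).congr_fun ?_
    (measurableSet_Icc.prod measurableSet_Icc)
  rintro ⟨x, y⟩ ⟨⟨hx, hx'⟩, ⟨hy, hy'⟩⟩
  dsimp at *
  rw [Set.indicator_of_mem]
  constructor <;> linarith

theorem integrable_inner_fracKernel (H : HurstIndex) {T : ℝ} {φ ψ : ℝ → V}
    (hφ : φ ∈ elementary T V) (hψ : ψ ∈ elementary T V) :
    Integrable (fun p : ℝ × ℝ => inner ℝ (φ p.1) (ψ p.2) * fracKernel H p.1 p.2)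
      ((leb T).prod (leb T)) := by
  obtain ⟨C, hC, h1⟩ := elementary_bounded hφ
  obtain ⟨D, hD, h2⟩ := elementary_bounded hψ
  have hk : Integrable (fun p : ℝ × ℝ => fracKernel H p.1 p.2) ((leb T).prod (leb T)) :=
    (integrable_abs_sub_rpow (by have := H.2.1; linarith) T).const_mul _
  refine hk.bdd_mul (c := C * D) ?_ (Filter.Eventually.of_forall fun p => ?_)
  · exact (((elementary_stronglyMeasurable hφ).comp_measurable measurable_fst).inner
      ((elementary_stronglyMeasurable hψ).comp_measurable measurable_snd)).aestronglyMeasurable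
  · exact (norm_inner_le_norm _ _).trans (mul_le_mul (h1 _) (h2 _) (norm_nonneg _) hC)

/-! ### Positivity of the kernel -/

/-- Truncated power kernel. -/
noncomputable def truncPow (q t r : ℝ) : ℝ := if r < t then (t - r) ^ (-q) else 0

theorem truncPow_nonneg (q t r : ℝ) : 0 ≤ truncPow q t r := by
  unfold truncPow; split_ifs with h
  · exact Real.rpow_nonneg (by linarith) _
  · exact le_rfl

theorem measurable_truncPow (q : ℝ) : Measurable fun z : ℝ × ℝ => truncPow q z.1 z.2 := by
  unfold truncPow
  exact Measurable.ite (measurableSet_lt measurable_snd measurable_fst)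
    ((measurable_fst.sub measurable_snd).pow_const _) measurable_const

theorem integrable_truncPow_mul {q d : ℝ} (hq : 1 / 2 < q) (hq' : q < 1) (hd : 0 < d) :
    IntegrableOn (fun v : ℝ => v ^ (-q) * (v + d) ^ (-q)) (Set.Ioi 0) := by
  rw [← Set.Ioc_union_Ioi_eq_Ioi (zero_le_one (α := ℝ))]
  have hm : Measurable (fun v : ℝ => v ^ (-q) * (v + d) ^ (-q)) := by fun_prop
  refine IntegrableOn.union ?_ ?_
  · have h1 : IntegrableOn (fun v : ℝ => v ^ (-q) * d ^ (-q)) (Set.Ioc 0 1) := by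
      have := (intervalIntegral.intervalIntegrable_rpow' (a := 0) (b := 1) (r := -q) (by linarith))
      rw [intervalIntegrable_iff_integrableOn_Ioc_of_le zero_le_one] at this
      exact this.mul_const _
    refine Integrable.mono' h1 hm.aestronglyMeasurable ?_
    filter_upwards [ae_restrict_mem measurableSet_Ioc] with v hv
    have h0 : (0 : ℝ) ≤ v ^ (-q) := Real.rpow_nonneg hv.1.le _
    have h2 : (0 : ℝ) ≤ (v + d) ^ (-q) := Real.rpow_nonneg (by linarith [hv.1]) _
    rw [Real.norm_of_nonneg (mul_nonneg h0 h2)]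
    exact mul_le_mul_of_nonneg_left
      (Real.rpow_le_rpow_of_nonpos hd (by linarith [hv.1]) (by linarith)) h0
  · have h1 : IntegrableOn (fun v : ℝ => v ^ (-(2 * q))) (Set.Ioi 1) :=
      integrableOn_Ioi_rpow_of_lt (by linarith) zero_lt_one
    refine Integrable.mono' h1 hm.aestronglyMeasurable ?_
    filter_upwards [ae_restrict_mem measurableSet_Ioi] with v hv
    have hv0 : (0 : ℝ) < v := zero_lt_one.trans hv
    have h0 : (0 : ℝ) ≤ v ^ (-q) := Real.rpow_nonneg hv0.le _
    have h2 : (0 : ℝ) ≤ (v + d) ^ (-q) := Real.rpow_nonneg (by linarith) _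
    rw [Real.norm_of_nonneg (mul_nonneg h0 h2)]
    have h3 : v ^ (-(2 * q)) = v ^ (-q) * v ^ (-q) := by
      rw [← Real.rpow_add hv0]; congr 1; ring
    rw [h3]
    exact mul_le_mul_of_nonneg_left
      (Real.rpow_le_rpow_of_nonpos hv0 (by linarith) (by linarith)) h0

theorem truncPow_mul_eq {q t d : ℝ} (hd : 0 < d) :
    (fun r => truncPow q t r * truncPow q (t + d) r) =
      fun r => (Set.Ioi (0 : ℝ)).indicator (fun v : ℝ => v ^ (-q) * (v + d) ^ (-q)) (t - r) := by
  funext r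
  by_cases h : r < t
  · rw [Set.indicator_of_mem (by simpa using h)]
    simp only [truncPow, h, if_pos (show r < t + d by linarith), if_true]
    congr 2; ring
  · rw [Set.indicator_of_notMem (by simpa using h)]
    simp [truncPow, h]

theorem integrable_truncPow_aux {q t d : ℝ} (hq : 1 / 2 < q) (hq' : q < 1) (hd : 0 < d) :
    Integrable (fun r => truncPow q t r * truncPow q (t + d) r) := by
  rw [truncPow_mul_eq hd]
  exact ((integrable_indicator_iff measurableSet_Ioi).2
    (integrable_truncPow_mul hq hq' hd)).comp_sub_left t

noncomputable def truncConst (q : ℝ) : ℝ := ∫ v in Set.Ioi (0 : ℝ), v ^ (-q) * (v + 1) ^ (-q)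

theorem truncConst_pos {q : ℝ} (hq : 1 / 2 < q) (hq' : q < 1) : 0 < truncConst q := by
  unfold truncConst
  rw [setIntegral_pos_iff_support_of_nonneg_ae]
  · refine lt_of_lt_of_le (b := volume (Set.Ioi (0 : ℝ))) (by simp) (measure_mono ?_)
    intro v hv
    refine ⟨?_, hv⟩
    have hv' : (0 : ℝ) < v := hv
    have : (0 : ℝ) < v ^ (-q) * (v + 1) ^ (-q) := by positivity
    exact this.ne'
  · filter_upwards [ae_restrict_mem measurableSet_Ioi] with v hv
    have hv' : (0 : ℝ) < v := hv
    show (0 : ℝ) ≤ v ^ (-q) * (v + 1) ^ (-q)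
    positivity
  · exact integrable_truncPow_mul hq hq' zero_lt_one

theorem integral_truncPow_aux {q t d : ℝ} (hd : 0 < d) :
    ∫ r, truncPow q t r * truncPow q (t + d) r = d ^ (1 - 2 * q) * truncConst q := by
  rw [truncPow_mul_eq hd]
  rw [integral_sub_left_eq_self (fun x => (Set.Ioi (0 : ℝ)).indicator
    (fun v : ℝ => v ^ (-q) * (v + d) ^ (-q)) x) volume t, integral_indicator measurableSet_Ioi]
  have h := integral_comp_mul_left_Ioi' (fun v : ℝ => v ^ (-q) * (v + d) ^ (-q)) 0 hd
  simp only [mul_zero] at h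
  rw [← h, smul_eq_mul]
  rw [truncConst, ← integral_const_mul, ← integral_const_mul]
  refine setIntegral_congr_fun measurableSet_Ioi fun v hv => ?_
  have hv' : (0 : ℝ) < v := hv
  have e1 : d * v + d = d * (v + 1) := by ring
  simp only [e1]
  rw [Real.mul_rpow hd.le hv'.le, Real.mul_rpow hd.le (by positivity : (0 : ℝ) ≤ v + 1)]
  have e2 : d ^ (1 - 2 * q) = d * d ^ (-q) * d ^ (-q) := by
    rw [show (1 - 2 * q : ℝ) = 1 + -q + -q by ring, Real.rpow_add hd, Real.rpow_add hd,
      Real.rpow_one]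
  rw [e2]; ring

theorem integrable_truncPow {q t s : ℝ} (hq : 1 / 2 < q) (hq' : q < 1) (hts : t ≠ s) :
    Integrable (fun r => truncPow q t r * truncPow q s r) := by
  rcases lt_or_gt_of_ne hts with h | h
  · simpa using integrable_truncPow_aux (t := t) hq hq' (sub_pos.2 h)
  · simpa [mul_comm] using integrable_truncPow_aux (t := s) hq hq' (sub_pos.2 h)

theorem integral_truncPow {q t s : ℝ} (hts : t ≠ s) :
    ∫ r, truncPow q t r * truncPow q s r = |t - s| ^ (1 - 2 * q) * truncConst q := by
  rcases lt_or_gt_of_ne hts with h | h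
  · have := integral_truncPow_aux (q := q) (t := t) (sub_pos.2 h)
    rw [abs_sub_comm, abs_of_pos (sub_pos.2 h), ← this]
    simp
  · have := integral_truncPow_aux (q := q) (t := s) (sub_pos.2 h)
    rw [abs_of_pos (sub_pos.2 h), ← this]
    simp [mul_comm]

theorem integrable_truncPow_leb {q : ℝ} (hq' : q < 1) (T r : ℝ) :
    Integrable (fun t => truncPow q t r) (leb T) := by
  have h0 : IntegrableOn (fun x : ℝ => |x - r| ^ (-q)) (Set.Icc 0 T) := by
    have h1 := (integrable_indicator_iff measurableSet_Icc).2
      (integrableOn_abs_rpow (q := -q) (by linarith) (|r| + |T|))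
    have h2 := (h1.comp_sub_right r).integrableOn (s := Set.Icc 0 T)
    refine h2.congr_fun (fun x hx => ?_) measurableSet_Icc
    have := hx.1; have := hx.2
    have := neg_abs_le r; have := le_abs_self r; have := le_abs_self T; have := abs_nonneg T
    dsimp only
    rw [Set.indicator_of_mem]
    constructor <;> linarith
  refine Integrable.mono' h0 ?_ (Filter.Eventually.of_forall fun t => ?_)
  · exact ((measurable_truncPow q).comp (measurable_id.prodMk measurable_const)).aestronglyMeasurable
  · rw [Real.norm_of_nonneg (truncPow_nonneg _ _ _)]
    unfold truncPow
    split_ifs with h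
    · rw [abs_of_pos (sub_pos.2 h)]
    · positivity

theorem integral_inner_self_nonneg {μ : Measure ℝ} [SFinite μ] [CompleteSpace V] {h : ℝ → V}
    (hh : Integrable h μ) : 0 ≤ ∫ p : ℝ × ℝ, inner ℝ (h p.1) (h p.2) ∂(μ.prod μ) := by
  have := integral_prod_bilin (μ := μ) (ν := μ) (innerSL ℝ : V →L[ℝ] V →L[ℝ] ℝ) hh hh
  refine le_of_le_of_eq ?_ this.symm
  exact real_inner_self_nonneg

theorem leb_prod_ae_ne (T : ℝ) : ∀ᵐ p ∂((leb T).prod (leb T)), p.1 ≠ p.2 := by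
  have : MeasurableSet {p : ℝ × ℝ | p.1 ≠ p.2} := (measurableSet_eq_fun measurable_fst measurable_snd).compl
  rw [Measure.ae_prod_iff_ae_ae this]
  refine Filter.Eventually.of_forall fun x => ?_
  have h2 : ∀ᵐ y ∂(leb T), y ≠ x := by
    rw [ae_iff]; simp [leb]
  filter_upwards [h2] with y hy using hy.symm

theorem integral_inner_fracKernel_nonneg [CompleteSpace V] (H : HurstIndex) {T : ℝ} {φ : ℝ → V}
    (hφ : φ ∈ elementary T V) :
    0 ≤ ∫ p : ℝ × ℝ, inner ℝ (φ p.1) (φ p.2) * fracKernel H p.1 p.2 ∂((leb T).prod (leb T)) := by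
  obtain ⟨hH1, hH2⟩ := H.2
  set q : ℝ := 3 / 2 - (H : ℝ) with hq
  have hq1 : 1 / 2 < q := by linarith
  have hq2 : q < 1 := by linarith
  have hC := truncConst_pos hq1 hq2
  have hsm := elementary_stronglyMeasurable hφ
  set F : (ℝ × ℝ) × ℝ → ℝ := fun z => inner ℝ (φ z.1.1) (φ z.1.2) *
    (truncPow q z.1.1 z.2 * truncPow q z.1.2 z.2) with hF
  have hin : StronglyMeasurable fun p : ℝ × ℝ => inner ℝ (φ p.1) (φ p.2) :=
    (hsm.comp_measurable measurable_fst).inner (hsm.comp_measurable measurable_snd)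
  have hFm : StronglyMeasurable F := by
    refine (hin.comp_measurable measurable_fst).mul (Measurable.stronglyMeasurable ?_)
    exact ((measurable_truncPow q).comp ((measurable_fst.comp measurable_fst).prodMk measurable_snd)).mul
      ((measurable_truncPow q).comp ((measurable_snd.comp measurable_fst).prodMk measurable_snd))
  have hfracKernel : ∀ p : ℝ × ℝ, |p.1 - p.2| ^ (1 - 2 * q) =
      ((H : ℝ) * (2 * (H : ℝ) - 1))⁻¹ * fracKernel H p.1 p.2 := by
    intro p
    have : (H : ℝ) * (2 * (H : ℝ) - 1) ≠ 0 := by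
      have h1 : (0 : ℝ) < H := by linarith
      have h2 : (0 : ℝ) < 2 * (H : ℝ) - 1 := by linarith
      positivity
    rw [fracKernel, ← mul_assoc, inv_mul_cancel₀ this, one_mul]
    congr 1; rw [hq]; ring
  have hcon : 0 < (H : ℝ) * (2 * (H : ℝ) - 1) := by
    have h1 : (0 : ℝ) < H := by linarith
    have h2 : (0 : ℝ) < 2 * (H : ℝ) - 1 := by linarith
    positivity
  have hFi : Integrable F (((leb T).prod (leb T)).prod volume) := by
    rw [integrable_prod_iff hFm.aestronglyMeasurable]
    constructor
    · filter_upwards [leb_prod_ae_ne T] with p hp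
      exact (integrable_truncPow hq1 hq2 hp).const_mul (inner ℝ (φ p.1) (φ p.2))
    · have hk := ((integrable_inner_fracKernel H hφ hφ).norm).mul_const
        (((H : ℝ) * (2 * (H : ℝ) - 1))⁻¹ * truncConst q)
      refine hk.congr ?_
      filter_upwards [leb_prod_ae_ne T] with p hp
      simp only [hF, norm_mul, Real.norm_of_nonneg (truncPow_nonneg _ _ _)]
      rw [integral_const_mul, integral_truncPow hp, hfracKernel p]
      have : 0 ≤ fracKernel H p.1 p.2 := by unfold fracKernel; positivity
      rw [Real.norm_of_nonneg this]; ring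
  have h1 : ∫ p : ℝ × ℝ, inner ℝ (φ p.1) (φ p.2) * fracKernel H p.1 p.2 ∂((leb T).prod (leb T)) =
      ((H : ℝ) * (2 * (H : ℝ) - 1) * (truncConst q)⁻¹) *
        ∫ p : ℝ × ℝ, (∫ r, F (p, r)) ∂((leb T).prod (leb T)) := by
    rw [← integral_const_mul]
    refine integral_congr_ae ?_
    filter_upwards [leb_prod_ae_ne T] with p hp
    simp only [hF]
    rw [integral_const_mul, integral_truncPow hp, hfracKernel p]
    have := hcon.ne'
    have := hC.ne'
    generalize (H : ℝ) * (2 * (H : ℝ) - 1) = c at *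
    field_simp
  rw [h1]
  refine mul_nonneg (by positivity) ?_
  rw [integral_integral_swap (f := fun p r => F (p, r)) hFi]
  refine integral_nonneg fun r => ?_
  obtain ⟨C, hC0, hCb⟩ := elementary_bounded hφ
  have hint : Integrable (fun t => truncPow q t r • φ t) (leb T) := by
    exact (integrable_truncPow_leb hq2 T r).smul_bdd C hsm.aestronglyMeasurable
      (Filter.Eventually.of_forall hCb)
  have := integral_inner_self_nonneg hint
  simp only [real_inner_smul_left, real_inner_smul_right] at this
  refine this.trans_eq (integral_congr_ae (Filter.Eventually.of_forall fun p => ?_))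
  simp only [hF]; ring

end

/-! ### The Hilbert spaces -/

section
variable {V : Type*} [NormedAddCommGroup V] [InnerProductSpace ℝ V] [CompleteSpace V]

/-- The space of elementary functions, to be normed by the inner product below. -/
def Elem (_H : HurstIndex) (T : ℝ) (V : Type*) [NormedAddCommGroup V] [InnerProductSpace ℝ V] :
    Type _ := elementary T V

/-- An elementary function as an element of `Elem H T V`. -/
def Elem.of (H : HurstIndex) {T : ℝ} (φ : ℝ → V) (hφ : φ ∈ elementary T V) : Elem H T V :=
  ⟨φ, hφ⟩

instance (H : HurstIndex) (T : ℝ) : AddCommGroup (Elem H T V) :=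
  inferInstanceAs (AddCommGroup (elementary T V))

instance (H : HurstIndex) (T : ℝ) : Module ℝ (Elem H T V) :=
  inferInstanceAs (Module ℝ (elementary T V))

/-- `⟨φ, ψ⟩ = α_H ∫_0^T ∫_0^T ⟨φ(t), ψ(s)⟩_V |t - s|^(2H-2) ds dt` on elementary functions. -/
@[reducible] noncomputable def elemCore (H : HurstIndex) (T : ℝ) :
    PreInnerProductSpace.Core ℝ (Elem H T V) where
  inner φ ψ := ∫ p : ℝ × ℝ, inner ℝ (φ.1 p.1) (ψ.1 p.2) * fracKernel H p.1 p.2 ∂((leb T).prod (leb T))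
  conj_inner_symm φ ψ := by
    simp only [conj_trivial]
    rw [← integral_prod_swap]
    refine integral_congr_ae (Eventually.of_forall fun p => ?_)
    simp only [Prod.fst_swap, Prod.snd_swap, fracKernel]
    rw [real_inner_comm, abs_sub_comm]
  re_inner_nonneg φ := integral_inner_fracKernel_nonneg H φ.2
  add_left φ ψ χ := by
    rw [← integral_add (integrable_inner_fracKernel H φ.2 χ.2) (integrable_inner_fracKernel H ψ.2 χ.2)]
    refine integral_congr_ae (Eventually.of_forall fun p => ?_)
    change inner ℝ (φ.1 p.1 + ψ.1 p.1) (χ.1 p.2) * _ = _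
    rw [inner_add_left, add_mul]
  smul_left φ ψ c := by
    simp only [conj_trivial]
    rw [← integral_const_mul]
    refine integral_congr_ae (Eventually.of_forall fun p => ?_)
    change inner ℝ (c • φ.1 p.1) (ψ.1 p.2) * _ = _
    rw [real_inner_smul_left, mul_assoc]

noncomputable instance (H : HurstIndex) (T : ℝ) : SeminormedAddCommGroup (Elem H T V) :=
  InnerProductSpace.Core.toSeminormedAddCommGroup (c := elemCore H T)

noncomputable instance (H : HurstIndex) (T : ℝ) : InnerProductSpace ℝ (Elem H T V) :=
  InnerProductSpace.ofCore (elemCore H T)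

theorem elem_inner_def {H : HurstIndex} {T : ℝ} (φ ψ : Elem H T V) :
    inner ℝ φ ψ = ∫ p : ℝ × ℝ, inner ℝ (φ.1 p.1) (ψ.1 p.2) * fracKernel H p.1 p.2
      ∂((leb T).prod (leb T)) := rfl

/-- The space `𝓗_V`: the completion of the elementary functions; the space `𝓗` is the case `V = ℝ`. -/
abbrev FracSpace (H : HurstIndex) (T : ℝ) (V : Type*) [NormedAddCommGroup V]
    [InnerProductSpace ℝ V] [CompleteSpace V] : Type _ :=
  Completion (Elem H T V)

theorem indicator_mem_elementary {T : ℝ} (t : Set.Icc (0 : ℝ) T) :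
    ((Set.Ioc 0 (t : ℝ)).indicator fun _ => (1 : ℝ)) ∈ elementary T ℝ :=
  Submodule.subset_span ⟨0, t, 1, le_rfl, t.2.1, t.2.2, rfl⟩

/-- The indicator function of `(0, t]`, as an element of `𝓗`. -/
noncomputable def indic (H : HurstIndex) (T : ℝ) (t : Set.Icc (0 : ℝ) T) : FracSpace H T ℝ :=
  (Elem.of H _ (indicator_mem_elementary t) : Elem H T ℝ)

/-- The map `φ ↦ φ(·) v` on elementary functions. -/
noncomputable def elemTimes (H : HurstIndex) (T : ℝ) (v : V) : Elem H T ℝ →L[ℝ] Elem H T V :=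
  LinearMap.mkContinuous
    { toFun := fun φ => Elem.of H (fun t => φ.1 t • v) (smul_mem_elementary φ.2 v)
      map_add' := fun φ ψ => Subtype.ext (funext fun t => add_smul (φ.1 t) (ψ.1 t) v)
      map_smul' := fun c φ => Subtype.ext (funext fun t => mul_smul c (φ.1 t) v) }
    ‖v‖ (fun φ => by
      refine le_of_sq_le_sq ?_ (by positivity)
      rw [mul_pow, ← real_inner_self_eq_norm_sq (F := Elem H T V),
        ← real_inner_self_eq_norm_sq (F := Elem H T ℝ), elem_inner_def, elem_inner_def,
        ← integral_const_mul]
      refine (integral_congr_ae (Eventually.of_forall fun p => ?_)).le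
      change inner ℝ (φ.1 p.1 • v) (φ.1 p.2 • v) * _ = _
      rw [real_inner_smul_left, real_inner_smul_right, real_inner_self_eq_norm_sq]
      change _ = _ * ((φ.1 p.2 * φ.1 p.1) * _)
      ring)

/-- The bounded linear map `𝓗 → 𝓗_V`, `φ ↦ φ v`, for a vector `v` of `V`. -/
noncomputable def timesVec (H : HurstIndex) (T : ℝ) (v : V) :
    FracSpace H T ℝ →L[ℝ] FracSpace H T V :=
  (elemTimes H T v).completion

end

/-- The Hilbert space tensor product. -/
abbrev HilbertTensor (E F : Type*) [NormedAddCommGroup E] [InnerProductSpace ℝ E]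
    [NormedAddCommGroup F] [InnerProductSpace ℝ F] : Type _ :=
  Completion (E ⊗[ℝ] F)

section
variable {V : Type*} [NormedAddCommGroup V] [InnerProductSpace ℝ V] [CompleteSpace V]

/-- The bounded linear map `𝓗 ⊗ 𝓗 → 𝓗_V ⊗ 𝓗_V`, `χ ↦ χ v ⊗ v`, that is,
`φ ⊗ ψ ↦ (φ v) ⊗ (ψ v)`. -/
noncomputable def timesVecTensor (H : HurstIndex) (T : ℝ) (v : V) :
    HilbertTensor (FracSpace H T ℝ) (FracSpace H T ℝ) →L[ℝ]
      HilbertTensor (FracSpace H T V) (FracSpace H T V) :=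
  (TensorProduct.mapL (timesVec H T v) (timesVec H T v)).completion

end

/-! ### Malliavin calculus over a Gaussian process indexed by a Hilbert space -/

section
variable {Ω : Type*} [MeasurableSpace Ω] {P : Measure Ω}
variable {K : Type*} [NormedAddCommGroup K] [InnerProductSpace ℝ K]

/-- Bounded smooth functions on `ℝⁿ` all of whose partial derivatives are bounded. -/
def IsCbSmooth {n : ℕ} (f : (Fin n → ℝ) → ℝ) : Prop :=
  ContDiff ℝ (⊤ : ℕ∞) f ∧ ∀ m : ℕ, ∃ C : ℝ, ∀ x, ‖iteratedFDeriv ℝ m f x‖ ≤ C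

/-- The pairs `(F, D F)` with `F = f(W(φ₁), …, W(φₙ))` smooth cylindrical and
`D F = ∑ᵢ ∂ᵢf(W(φ₁), …, W(φₙ)) φᵢ`. -/
def smoothPairs (W : K → Lp ℝ 2 P) : Set (Lp ℝ 2 P × Lp K 2 P) :=
  {p | ∃ (n : ℕ) (f : (Fin n → ℝ) → ℝ) (φ : Fin n → K), 1 ≤ n ∧ IsCbSmooth f ∧
    (p.1 =ᵐ[P] fun ω => f (fun i => W (φ i) ω)) ∧
    (p.2 =ᵐ[P] fun ω =>
      ∑ i, fderiv ℝ f (fun j => W (φ j) ω) (Pi.single i 1) • φ i)}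

/-- The space `𝔻^{1,2}_W`: the completion of the smooth cylindrical random variables `F` for
`‖F‖² = E|F|² + E‖D F‖²`. It is realized as the closure of the set of the pairs `(F, D F)` in
`L²(Ω) × L²(Ω; K)`, so that an element of `𝔻^{1,2}_W` is a pair whose first component is the random
variable and whose second component is its Malliavin derivative. -/
noncomputable def sobolev (W : K → Lp ℝ 2 P) : Submodule ℝ (WithLp 2 (Lp ℝ 2 P × Lp K 2 P)) :=
  (Submodule.span ℝ {x | (x.fst, x.snd) ∈ smoothPairs W}).topologicalClosure

section
variable (V' : Type*) [NormedAddCommGroup V'] [InnerProductSpace ℝ V']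

/-- The space `𝔻^{1,2}_W(V')`: the completion of the space of the sums `U = ∑ⱼ Fⱼ φⱼ`, with `Fⱼ`
smooth cylindrical and `φⱼ ∈ V'`, for `‖U‖² = E‖U‖² + E‖D U‖²`, where `D U = ∑ⱼ D Fⱼ ⊗ φⱼ`. As above,
an element is a pair `(U, D U)`; the norm of this Hilbert space is the one of the pair. -/
noncomputable def sobolevV (W : K → Lp ℝ 2 P) :
    Submodule ℝ (WithLp 2 (Lp V' 2 P × Lp (HilbertTensor K V') 2 P)) :=
  (Submodule.span ℝ {x | ∃ p ∈ smoothPairs W, ∃ v : V',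
    (x.fst =ᵐ[P] fun ω => p.1 ω • v) ∧
    (x.snd =ᵐ[P] fun ω => ((p.2 ω ⊗ₜ[ℝ] v : K ⊗[ℝ] V') : HilbertTensor K V'))}).topologicalClosure

end

/-- `X = δ(U)`: the duality relation `E(F X) = E⟨D F, U⟩` for all `F ∈ 𝔻^{1,2}_W`, where `X` lies in
the closure of `𝔻^{1,2}_W` in `L²(Ω)` (this closure is the space of the square integrable random
variables that are measurable with respect to the completed σ-algebra generated by `W`, and the
adjoint of `D` takes its values there). -/
def IsSkorohod (W : K → Lp ℝ 2 P) (U : Lp K 2 P) (X : Lp ℝ 2 P) : Prop :=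
  X ∈ ((sobolev W).map (WithLp.fstₗ 2 ℝ (Lp ℝ 2 P) (Lp K 2 P))).topologicalClosure ∧
    ∀ F ∈ sobolev W, ∫ ω, F.fst ω * X ω ∂P = ∫ ω, inner ℝ (F.snd ω) (U ω) ∂P

theorem IsSkorohod.unique {W : K → Lp ℝ 2 P} {U : Lp K 2 P} {X Y : Lp ℝ 2 P}
    (hX : IsSkorohod W U X) (hY : IsSkorohod W U Y) : X = Y := by
  set M := (sobolev W).map (WithLp.fstₗ 2 ℝ (Lp ℝ 2 P) (Lp K 2 P)) with hM
  have h1 : X - Y ∈ M.topologicalClosure := Submodule.sub_mem _ hX.1 hY.1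
  have h2 : X - Y ∈ Mᗮ := by
    rw [Submodule.mem_orthogonal]
    rintro _ ⟨F, hF, rfl⟩
    have h3 := (hX.2 F hF).trans (hY.2 F hF).symm
    have h4 : ∀ Z : Lp ℝ 2 P, inner ℝ F.fst Z = ∫ ω, F.fst ω * Z ω ∂P := fun Z => by
      rw [L2.inner_def]
      exact integral_congr_ae (Eventually.of_forall fun ω => by simp [mul_comm])
    change inner ℝ F.fst (X - Y) = 0
    rw [inner_sub_right, h4, h4, h3, sub_self]
  rw [← Submodule.orthogonal_closure] at h2
  exact sub_eq_zero.1 (Submodule.disjoint_def.1 (Submodule.orthogonal_disjoint _) _ h1 h2)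

/-- The domain of the Skorohod integral `δ`. -/
def skorohodDom (W : K → Lp ℝ 2 P) : Set (Lp K 2 P) :=
  {U | ∃ X, IsSkorohod W U X}

open scoped Classical in
/-- The Skorohod integral `δ(U)`, for `U` in the domain. -/
noncomputable def skorohod (W : K → Lp ℝ 2 P) (U : Lp K 2 P) : Lp ℝ 2 P :=
  if h : U ∈ skorohodDom W then h.choose else 0

theorem isSkorohod_skorohod {W : K → Lp ℝ 2 P} {U : Lp K 2 P} (h : U ∈ skorohodDom W) :
    IsSkorohod W U (skorohod W U) := by
  rw [skorohod, dif_pos h]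
  exact h.choose_spec

end

/-! ### Fractional Brownian motions and the Gaussian processes they generate -/

section
variable {Ω : Type*} [MeasurableSpace Ω] {P : Measure Ω} {H : HurstIndex} {T : ℝ}

/-- Fractional Brownian motion of Hurst index `H` on `[0, T]`. -/
structure IsFBM (H : HurstIndex) (T : ℝ) (β : Set.Icc (0 : ℝ) T → Ω → ℝ) (P : Measure Ω) :
    Prop where
  measurable : ∀ t, Measurable (β t)
  gaussian : IsGaussianProcess β P
  mean : ∀ t, ∫ ω, β t ω ∂P = 0
  cov : ∀ t s, ∫ ω, β t ω * β s ω ∂P =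
    ((t : ℝ) ^ (2 * (H : ℝ)) + (s : ℝ) ^ (2 * (H : ℝ)) - |(t : ℝ) - s| ^ (2 * (H : ℝ))) / 2

theorem IsFBM.memLp {β : Set.Icc (0 : ℝ) T → Ω → ℝ} (hβ : IsFBM H T β P) (t : Set.Icc (0 : ℝ) T) :
    MemLp (β t) 2 P :=
  (hβ.gaussian.hasGaussianLaw_eval t).memLp_two

/-- The Wiener integral `φ ↦ β(φ)`, `φ ∈ 𝓗`: the continuous linear extension of `1_{(0,t]} ↦ β_t`. -/
noncomputable def wiener {β : Set.Icc (0 : ℝ) T → Ω → ℝ} (hβ : IsFBM H T β P) :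
    FracSpace H T ℝ →L[ℝ] Lp ℝ 2 P :=
  LinearMap.extendOfNorm
    (Finsupp.linearCombination ℝ fun t => (hβ.memLp t).toLp)
    (Finsupp.linearCombination ℝ (indic H T))

theorem integral_abs_rpow' {q : ℝ} (hq : -1 < q) (x : ℝ) :
    ∫ z in (0 : ℝ)..x, |z| ^ q = x * |x| ^ q / (q + 1) := by
  have key : ∀ y : ℝ, 0 ≤ y → ∫ z in (0 : ℝ)..y, |z| ^ q = y * |y| ^ q / (q + 1) := by
    intro y hy
    have h1 : ∫ z in (0 : ℝ)..y, |z| ^ q = ∫ z in (0 : ℝ)..y, z ^ q :=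
      intervalIntegral.integral_congr fun z hz => by
        rw [Set.uIcc_of_le hy] at hz
        simp only [abs_of_nonneg hz.1]
    rw [h1, integral_rpow (Or.inl hq), abs_of_nonneg hy, Real.zero_rpow (by linarith), sub_zero,
      Real.rpow_add_one' hy (by linarith), mul_comm y]
  rcases le_total 0 x with hx | hx
  · exact key x hx
  · have h2 := intervalIntegral.integral_comp_neg (a := 0) (b := -x) (fun z : ℝ => |z| ^ q)
    simp only [abs_neg, neg_neg, neg_zero] at h2
    rw [intervalIntegral.integral_symm, ← h2, key (-x) (by linarith), abs_neg]
    ring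

theorem integral_mul_abs_rpow {q : ℝ} (hq : -1 < q) (x : ℝ) :
    ∫ z in (0 : ℝ)..x, z * |z| ^ q = |x| ^ (q + 2) / (q + 2) := by
  have key : ∀ y : ℝ, 0 ≤ y → ∫ z in (0 : ℝ)..y, z * |z| ^ q = |y| ^ (q + 2) / (q + 2) := by
    intro y hy
    have h1 : ∫ z in (0 : ℝ)..y, z * |z| ^ q = ∫ z in (0 : ℝ)..y, z ^ (q + 1) :=
      intervalIntegral.integral_congr fun z hz => by
        rw [Set.uIcc_of_le hy] at hz
        simp only [abs_of_nonneg hz.1]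
        rw [Real.rpow_add_one' hz.1 (by linarith), mul_comm]
    rw [h1, integral_rpow (Or.inl (by linarith)), abs_of_nonneg hy, Real.zero_rpow (by linarith),
      sub_zero, show q + 1 + 1 = q + 2 by ring]
  rcases le_total 0 x with hx | hx
  · exact key x hx
  · have h2 := intervalIntegral.integral_comp_neg (a := 0) (b := -x) (fun z : ℝ => z * |z| ^ q)
    simp only [abs_neg, neg_neg, neg_zero, neg_mul] at h2
    rw [intervalIntegral.integral_symm, ← h2, intervalIntegral.integral_neg, key (-x) (by linarith),
      abs_neg]
    ring

theorem inner_indic (H : HurstIndex) (T : ℝ) (t s : Set.Icc (0 : ℝ) T) :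
    inner ℝ (indic H T t) (indic H T s) =
      ((t : ℝ) ^ (2 * (H : ℝ)) + (s : ℝ) ^ (2 * (H : ℝ)) - |(t : ℝ) - s| ^ (2 * (H : ℝ))) / 2 := by
  obtain ⟨hH1, hH2⟩ := H.2
  have hmt := indicator_mem_elementary t
  have hms := indicator_mem_elementary s
  have e0 : (inner ℝ (indic H T t) (indic H T s) : ℝ) = ∫ p : ℝ × ℝ,
      inner ℝ ((Set.Ioc 0 (t : ℝ)).indicator (fun _ => (1 : ℝ)) p.1)
        ((Set.Ioc 0 (s : ℝ)).indicator (fun _ => (1 : ℝ)) p.2) * fracKernel H p.1 p.2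
      ∂((leb T).prod (leb T)) := by
    rw [indic, indic, Completion.inner_coe]; rfl
  rw [e0]
  clear e0
  obtain ⟨ht0, htT⟩ := t.2
  obtain ⟨hs0, hsT⟩ := s.2
  generalize (t : ℝ) = t at *
  generalize (s : ℝ) = s at *
  set q : ℝ := 2 * (H : ℝ) - 2 with hq
  have hq1 : -1 < q := by linarith
  have hii : ∀ a b : ℝ, IntervalIntegrable (fun z : ℝ => |z| ^ q) volume a b := fun a b => by
    have h := (integrableOn_abs_rpow hq1 (|a| + |b|))
    refine (h.mono_set ?_).intervalIntegrable
    intro z hz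
    have h1 := neg_abs_le a; have h2 := neg_abs_le b
    have h3 := le_abs_self a; have h4 := le_abs_self b
    have h5 := abs_nonneg a; have h6 := abs_nonneg b
    rcases Set.mem_uIcc.1 hz with h | h <;> constructor <;> linarith [h.1, h.2]
  have hcont : Continuous fun z : ℝ => z * |z| ^ q := by
    have : (fun z : ℝ => z * |z| ^ q) = fun z => (q + 1) * ∫ y in (0 : ℝ)..z, |y| ^ q := by
      funext z; rw [integral_abs_rpow' hq1]; field_simp [show q + 1 ≠ 0 by linarith]
    rw [this]
    exact continuous_const.mul (intervalIntegral.continuous_primitive hii 0)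
  have hinner : ∀ x : ℝ, ∫ y in (0 : ℝ)..s, |x - y| ^ q =
      (x * |x| ^ q - (x - s) * |x - s| ^ q) / (q + 1) := fun x => by
    rw [intervalIntegral.integral_comp_sub_left (fun z => |z| ^ q) x, sub_zero,
      ← intervalIntegral.integral_interval_sub_left (hii 0 x) (hii 0 (x - s)),
      integral_abs_rpow' hq1, integral_abs_rpow' hq1]
    ring
  have hprod := integral_prod _ (integrable_inner_fracKernel H hmt hms)
  refine hprod.trans ?_
  have hsub : ∀ (a : ℝ), a ≤ T → ∀ g : ℝ → ℝ, 0 ≤ a →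
      ∫ x, (Set.Ioc 0 a).indicator (fun _ => (1 : ℝ)) x * g x ∂(leb T) = ∫ x in (0 : ℝ)..a, g x := by
    intro a haT g ha0
    rw [intervalIntegral.integral_of_le ha0, leb]
    have : (fun x => (Set.Ioc 0 a).indicator (fun _ => (1 : ℝ)) x * g x) =
        (Set.Ioc 0 a).indicator g := by
      funext x; by_cases hx : x ∈ Set.Ioc 0 a <;> simp [hx]
    rw [this, integral_indicator measurableSet_Ioc, Measure.restrict_restrict measurableSet_Ioc]
    congr 2
    exact Set.inter_eq_left.2 fun x hx => ⟨hx.1.le, hx.2.trans haT⟩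
  have h1 : ∀ x : ℝ, ∫ y, inner ℝ ((Set.Ioc 0 t).indicator (fun _ => (1 : ℝ)) x)
      ((Set.Ioc 0 s).indicator (fun _ => (1 : ℝ)) y) * fracKernel H x y ∂(leb T) =
      (Set.Ioc 0 t).indicator (fun _ => (1 : ℝ)) x *
        ((H : ℝ) * ((x * |x| ^ q - (x - s) * |x - s| ^ q))) := fun x => by
    have : (fun y => inner ℝ ((Set.Ioc 0 t).indicator (fun _ => (1 : ℝ)) x)
      ((Set.Ioc 0 s).indicator (fun _ => (1 : ℝ)) y) * fracKernel H x y) = fun y =>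
      ((Set.Ioc 0 t).indicator (fun _ => (1 : ℝ)) x * ((H : ℝ) * (2 * (H : ℝ) - 1))) *
        ((Set.Ioc 0 s).indicator (fun _ => (1 : ℝ)) y * |x - y| ^ q) := by
      funext y
      simp only [fracKernel, ← hq]
      change ((Set.Ioc 0 s).indicator (fun _ => (1 : ℝ)) y *
        (Set.Ioc 0 t).indicator (fun _ => (1 : ℝ)) x) * _ = _
      ring
    rw [this, integral_const_mul, hsub s hsT _ hs0, hinner]
    have h2 : q + 1 = 2 * (H : ℝ) - 1 := by rw [hq]; ring
    have h3 : (2 * (H : ℝ) - 1) ≠ 0 := by linarith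
    rw [h2]
    generalize 2 * (H : ℝ) - 1 = c at *
    field_simp
  rw [integral_congr_ae (Eventually.of_forall h1), hsub t htT _ ht0,
    intervalIntegral.integral_const_mul, intervalIntegral.integral_sub
      (hcont.intervalIntegrable _ _)
      (Continuous.intervalIntegrable (u := fun x => (x - s) * |x - s| ^ q)
        (hcont.comp (continuous_id.sub continuous_const)) _ _),
    integral_mul_abs_rpow hq1,
    intervalIntegral.integral_comp_sub_right (fun z => z * |z| ^ q) s,
    ← intervalIntegral.integral_interval_sub_left (hcont.intervalIntegrable 0 (t - s))
      (hcont.intervalIntegrable 0 (0 - s)), integral_mul_abs_rpow hq1, integral_mul_abs_rpow hq1]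
  have h2 : q + 2 = 2 * (H : ℝ) := by rw [hq]; ring
  have h3 : (H : ℝ) ≠ 0 := by linarith
  rw [h2, zero_sub, abs_neg, abs_of_nonneg ht0, abs_of_nonneg hs0]
  field_simp
  ring

theorem span_indic (H : HurstIndex) (T : ℝ) :
    DenseRange (Finsupp.linearCombination ℝ (indic H T)) := by
  have hr : ∀ φ : Elem H T ℝ,
      (φ : FracSpace H T ℝ) ∈ LinearMap.range (Finsupp.linearCombination ℝ (indic H T)) := by
    rw [Finsupp.range_linearCombination]
    suffices h : ∀ (φ : ℝ → ℝ) (hφ : φ ∈ elementary T ℝ),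
        (Elem.of H φ hφ : FracSpace H T ℝ) ∈ Submodule.span ℝ (Set.range (indic H T)) from
      fun φ => h φ.1 φ.2
    intro φ hφ
    induction hφ using Submodule.span_induction with
    | mem x h =>
      obtain ⟨a, b, v, ha, hab, hb, rfl⟩ := h
      have : Elem.of H ((Set.Ioc a b).indicator fun _ => v)
          (Submodule.subset_span ⟨a, b, v, ha, hab, hb, rfl⟩) =
          v • (Elem.of H _ (indicator_mem_elementary (T := T) ⟨b, ha.trans hab, hb⟩) -
            Elem.of H _ (indicator_mem_elementary (T := T) ⟨a, ha, hab.trans hb⟩)) := by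
        refine Subtype.ext (funext fun t => ?_)
        change (Set.Ioc a b).indicator (fun _ => v) t = v * ((Set.Ioc 0 b).indicator (fun _ => (1 : ℝ)) t -
          (Set.Ioc 0 a).indicator (fun _ => (1 : ℝ)) t)
        simp only [Set.indicator_apply, Set.mem_Ioc]
        split_ifs <;> first | (exfalso; grind) | simp
      rw [this, Completion.coe_smul, Completion.coe_sub]
      exact Submodule.smul_mem _ _ (Submodule.sub_mem _
        (Submodule.subset_span ⟨_, rfl⟩) (Submodule.subset_span ⟨_, rfl⟩))
    | zero => exact Submodule.zero_mem _
    | add x y hx hy h1 h2 =>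
      have := Submodule.add_mem _ h1 h2
      rwa [← Completion.coe_add] at this
    | smul c x hx h1 =>
      have := Submodule.smul_mem _ c h1
      rwa [← Completion.coe_smul] at this
  exact (Completion.denseRange_coe (α := Elem H T ℝ)).mono
    (by rintro _ ⟨φ, rfl⟩; exact hr φ)

/-- The Wiener integral is an isometric extension of `1_{(0,t]} ↦ β_t`. -/
theorem norm_linearCombination_eq {β : Set.Icc (0 : ℝ) T → Ω → ℝ} (hβ : IsFBM H T β P)
    (c : Set.Icc (0 : ℝ) T →₀ ℝ) :
    ‖Finsupp.linearCombination ℝ (fun t => (hβ.memLp t).toLp) c‖ =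
      ‖Finsupp.linearCombination ℝ (indic H T) c‖ := by
  have h : ∀ t s, (inner ℝ ((hβ.memLp t).toLp) ((hβ.memLp s).toLp) : ℝ) =
      inner ℝ (indic H T t) (indic H T s) := fun t s => by
    rw [inner_indic, ← hβ.cov, L2.inner_def]
    refine integral_congr_ae ?_
    filter_upwards [(hβ.memLp t).coeFn_toLp, (hβ.memLp s).coeFn_toLp] with ω h1 h2
    rw [h1, h2]
    simp [mul_comm]
  rw [← sq_eq_sq₀ (norm_nonneg _) (norm_nonneg _), ← real_inner_self_eq_norm_sq,
    ← real_inner_self_eq_norm_sq]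
  simp only [Finsupp.linearCombination_apply, Finsupp.sum, sum_inner, inner_sum,
    real_inner_smul_left, real_inner_smul_right, h]

theorem wiener_indic {β : Set.Icc (0 : ℝ) T → Ω → ℝ} (hβ : IsFBM H T β P) (t : Set.Icc (0 : ℝ) T) :
    wiener hβ (indic H T t) = (hβ.memLp t).toLp := by
  have := LinearMap.extendOfNorm_eq
    (f := Finsupp.linearCombination ℝ fun t => (hβ.memLp t).toLp) (span_indic H T)
    ⟨1, fun c => by rw [one_mul]; exact (norm_linearCombination_eq hβ c).le⟩ (Finsupp.single t 1)
  simpa [wiener] using this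

variable {V : Type*} [NormedAddCommGroup V] [InnerProductSpace ℝ V] [CompleteSpace V]

/-- The `k`-th coordinate `φᵏ = ⟨φ, e_k⟩_V ∈ 𝓗` of `φ ∈ 𝓗_V`, with `v = e_k`: the adjoint of
`φ ↦ φ v`, which is the continuous extension of the map `φ ↦ ⟨φ(·), v⟩_V` of elementary functions. -/
noncomputable def coord (H : HurstIndex) (T : ℝ) (v : V) :
    FracSpace H T V →L[ℝ] FracSpace H T ℝ :=
  ContinuousLinearMap.adjoint (timesVec H T v)

/-- The process `B(φ) = ∑ₖ βᵏ(φᵏ)`, `φ = ∑ₖ φᵏ e_k ∈ 𝓗_V`; the series converges in `L²(Ω)`. -/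
noncomputable def jointProcess (e : HilbertBasis ℕ ℝ V) {β : ℕ → Set.Icc (0 : ℝ) T → Ω → ℝ}
    (hβ : ∀ k, IsFBM H T (β k) P) (φ : FracSpace H T V) : Lp ℝ 2 P :=
  ∑' k, wiener (hβ k) (coord H T (e k) φ)

end

end FracMalliavin

open FracMalliavin

namespace FracMalliavin

/-! ### Gaussian integration by parts -/

section

/-! For a unit vector eₖ the map (u, Du) ↦ (u eₖ, (Du) eₖ ⊗ eₖ) is isometric, and its ranges for
different k are orthogonal, because ⟨φ v, ψ w⟩ = ⟨v, w⟩⟨φ, ψ⟩ in 𝓗_V. Square summability of the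
norms therefore makes ∑ uᵏ eₖ converge together with its derivative, and Pythagoras gives the norm
identity (`orthogonalFamily_pairTimes`). The terms lie in 𝔻^{1,2}_B since B(φ eₖ) = βᵏ(φ): a smooth
cylindrical F of βᵏ is one of B, with D^B F = (D^{βᵏ}F) eₖ (`IsSmoothCyl.jointProcess`).

For the Skorohod integrals the point is the bound E|δ(U)|² ≤ ‖U‖² in 𝔻^{1,2}, valid for every
isonormal process W. One puts δ(F v) = F W(v) − ⟨DF, v⟩ for smooth cylindrical F. Gaussian
integration by parts yields the duality with D and the energy identity E δ(U)δ(U') = E⟨U, U'⟩ +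
E⟨DU, (DU')*⟩, where * exchanges the tensor factors. Both are identities between continuous bilinear
forms, so they pass to the closure `skorohodGraph` of the pairs ((U, DU), δ(U)). The resulting bound
shows that this closure is a graph over all of 𝔻^{1,2}_W(K) (`exists_mem_skorohodGraph`).
Multiplication by eₖ carries the graph for βᵏ into the graph for B without changing the second
component (`pairTimes_mem_skorohodGraph`), so δ^B(uᵏ eₖ) = δ^{βᵏ}(uᵏ), and the bound gives
convergence of the series.

It remains to know that the βᵏ(·) and B are isonormal. The isometry property comes from the
covariance and from independence; Gaussian laws survive L² limits because `centredGaussian P` is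
closed. -/

theorem hasDerivAt_gaussianPDFReal_zero_one (x : ℝ) :
    HasDerivAt (gaussianPDFReal 0 1) (-(x * gaussianPDFReal 0 1 x)) x := by
  have h : gaussianPDFReal 0 1 =
      fun x => (√(2 * Real.pi * (1 : NNReal)))⁻¹ * Real.exp (-(x - 0) ^ 2 / (2 * (1 : NNReal))) := rfl
  rw [h]
  have h1 : HasDerivAt (fun x : ℝ => -(x - 0) ^ 2 / (2 * ((1 : NNReal) : ℝ))) (-x) x := by
    have := (((hasDerivAt_id x).sub_const 0).pow 2).neg.div_const (2 * ((1 : NNReal) : ℝ))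
    refine this.congr_deriv ?_
    simp only [id, sub_zero, NNReal.coe_one, Nat.cast_ofNat]
    ring
  refine (h1.exp.const_mul _).congr_deriv ?_
  ring

theorem integrable_gaussianReal_iff {f : ℝ → ℝ} :
    Integrable f (gaussianReal 0 1) ↔ Integrable fun x => gaussianPDFReal 0 1 x * f x := by
  rw [gaussianReal_of_var_ne_zero _ one_ne_zero,
    integrable_withDensity_iff_integrable_smul' (measurable_gaussianPDF 0 1)
      (Eventually.of_forall fun _ => gaussianPDF_lt_top)]
  simp only [toReal_gaussianPDF, smul_eq_mul]

theorem memLp_of_linear_growth {g : ℝ → ℝ} (hg : Continuous g) {C : ℝ}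
    (hC : ∀ x, |g x| ≤ C * (1 + |x|)) : MemLp g 2 (gaussianReal 0 1) := by
  have h1 : MemLp (fun x : ℝ => C * (1 + |x|)) 2 (gaussianReal 0 1) := by
    have h2 : MemLp (fun x : ℝ => |x|) 2 (gaussianReal 0 1) :=
      (memLp_id_gaussianReal' (μ := 0) (v := 1) 2 (by simp)).abs
    exact ((memLp_const (1 : ℝ)).add h2).const_mul C
  refine h1.mono hg.aestronglyMeasurable (Eventually.of_forall fun x => ?_)
  exact (hC x).trans (le_abs_self _)

/-- Stein's identity for the standard Gaussian law. -/
theorem integral_mul_id_gaussianReal {g g' : ℝ → ℝ} (hg : ∀ x, HasDerivAt g (g' x) x)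
    (hg' : Continuous g') {C : ℝ} (hC : ∀ x, |g x| ≤ C * (1 + |x|))
    (hC' : ∀ x, |g' x| ≤ C * (1 + |x|)) :
    ∫ x, g x * x ∂(gaussianReal 0 1) = ∫ x, g' x ∂(gaussianReal 0 1) := by
  have hgc : Continuous g := continuous_iff_continuousAt.2 fun x => (hg x).continuousAt
  have m := memLp_of_linear_growth hgc hC
  have m' := memLp_of_linear_growth hg' hC'
  have mi : MemLp (fun x : ℝ => x) 2 (gaussianReal 0 1) :=
    memLp_id_gaussianReal' (μ := 0) (v := 1) 2 (by simp)
  have i1 : Integrable (fun x => g x * x) (gaussianReal 0 1) := m.integrable_mul mi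
  have i2 := m'.integrable one_le_two
  have i3 := m.integrable one_le_two
  rw [integrable_gaussianReal_iff] at i1 i2 i3
  rw [integral_gaussianReal_eq_integral_smul one_ne_zero,
    integral_gaussianReal_eq_integral_smul one_ne_zero]
  -- Integration by parts against the density, whose derivative is −x times itself; integrability of
  -- the three products over ℝ leaves no boundary term.
  have := integral_mul_deriv_eq_deriv_mul_of_integrable (u := g) (u' := g')
    (v := gaussianPDFReal 0 1) (v' := fun x => -(x * gaussianPDFReal 0 1 x))
    (fun x _ => hg x) (fun x _ => hasDerivAt_gaussianPDFReal_zero_one x)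
    (i1.neg.congr (Eventually.of_forall fun x => by simp; ring))
    (i2.congr (Eventually.of_forall fun x => by simp; ring))
    (i3.congr (Eventually.of_forall fun x => by simp; ring))
  have e : ∫ x, g x * -(x * gaussianPDFReal 0 1 x) = -∫ x, gaussianPDFReal 0 1 x • (g x * x) := by
    rw [← integral_neg]
    exact integral_congr_ae (Eventually.of_forall fun x => by simp; ring)
  rw [e, neg_inj] at this
  rw [this]
  exact integral_congr_ae (Eventually.of_forall fun x => by simp; ring)

variable {Ω : Type*} [MeasurableSpace Ω] {P : Measure Ω}
theorem IsIsonormal.aemeasurable {K : Type*} (W : K → Lp ℝ 2 P) (φ : K) : AEMeasurable (W φ) P :=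
  (Lp.aestronglyMeasurable (W φ)).aemeasurable

variable {K : Type*} [NormedAddCommGroup K] [InnerProductSpace ℝ K]

/-- Isonormal Gaussian processes: linear maps `W : K → L²(Ω)` such that `W φ` has the law
`N(0, ‖φ‖²)`. -/
structure IsIsonormal (W : K → Lp ℝ 2 P) : Prop where
  map_add : ∀ φ ψ, W (φ + ψ) = W φ + W ψ
  map_smul : ∀ (c : ℝ) φ, W (c • φ) = c • W φ
  law : ∀ φ, P.map (W φ) = gaussianReal 0 (‖φ‖₊ ^ 2)

namespace IsIsonormal

variable {W : K → Lp ℝ 2 P}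

/-- An isonormal process as a linear map. -/
def toLinearMap (hW : IsIsonormal W) : K →ₗ[ℝ] Lp ℝ 2 P where
  toFun := W
  map_add' := hW.map_add
  map_smul' := hW.map_smul

theorem map_sum_smul (hW : IsIsonormal W) {ι : Type*} [Fintype ι] (c : ι → ℝ) (φ : ι → K) :
    W (∑ i, c i • φ i) =ᵐ[P] fun ω => ∑ i, c i * W (φ i) ω := by
  have : W (∑ i, c i • φ i) = ∑ i, c i • W (φ i) := by
    change hW.toLinearMap _ = _
    rw [map_sum]
    exact Finset.sum_congr rfl fun i _ => hW.map_smul _ _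
  rw [this]
  have h2 : ∀ᵐ ω ∂P, ∀ i, (c i • W (φ i) : Lp ℝ 2 P) ω = c i * W (φ i) ω :=
    ae_all_iff.2 fun i => by
      filter_upwards [Lp.coeFn_smul (c i) (W (φ i))] with ω h using by simpa using h
  filter_upwards [h2, Lp.coeFn_finsetSum Finset.univ (fun i => c i • W (φ i))] with ω h h'
  rw [h']
  simp [h]

theorem integral_eq_zero (hW : IsIsonormal W) (φ : K) : ∫ ω, W φ ω ∂P = 0 := by
  have := integral_map (aemeasurable W φ) (f := fun x : ℝ => x)
    measurable_id.aestronglyMeasurable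
  rw [← this, hW.law, integral_id_gaussianReal]

theorem norm_map (hW : IsIsonormal W) (φ : K) : ‖W φ‖ = ‖φ‖ := by
  have h1 : Var[W φ; P] = ‖φ‖ ^ 2 := by
    have := variance_map (X := fun x : ℝ => x) (Y := W φ) (μ := P)
      aemeasurable_id (aemeasurable W φ)
    rw [hW.law, variance_fun_id_gaussianReal] at this
    simpa [Function.comp_def] using this.symm
  rw [variance_of_integral_eq_zero (aemeasurable W φ) (hW.integral_eq_zero φ)] at h1
  rw [← sq_eq_sq₀ (norm_nonneg _) (norm_nonneg _), ← h1, ← real_inner_self_eq_norm_sq,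
    L2.inner_def]
  exact integral_congr_ae (Eventually.of_forall fun ω => by simp [sq])

/-- An isonormal process as a linear isometry. -/
def toLinearIsometry (hW : IsIsonormal W) : K →ₗᵢ[ℝ] Lp ℝ 2 P where
  toLinearMap := hW.toLinearMap
  norm_map' := hW.norm_map

theorem inner_map (hW : IsIsonormal W) (φ ψ : K) : inner ℝ (W φ) (W ψ) = inner ℝ φ ψ :=
  hW.toLinearIsometry.inner_map_map φ ψ

theorem integral_mul (hW : IsIsonormal W) (φ ψ : K) :
    ∫ ω, W φ ω * W ψ ω ∂P = inner ℝ φ ψ := by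
  rw [← hW.inner_map, L2.inner_def]
  exact integral_congr_ae (Eventually.of_forall fun ω => by simp [mul_comm])

/-- A linear form L in the W(φᵢ) is almost surely W(∑ L(eᵢ) φᵢ), so linearity of W turns the
one-dimensional laws into joint Gaussianity. -/
theorem hasGaussianLaw (hW : IsIsonormal W) {ι : Type*} [Fintype ι] (φ : ι → K) :
    HasGaussianLaw (fun ω i => W (φ i) ω) P := by
  have hm : AEMeasurable (fun ω i => W (φ i) ω) P :=
    aemeasurable_pi_lambda _ fun i => aemeasurable W (φ i)
  refine ⟨isGaussian_of_map_eq_gaussianReal fun L => ?_⟩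
  classical
  refine ⟨0, ‖∑ i, L (Pi.single i 1) • φ i‖₊ ^ 2, ?_⟩
  rw [AEMeasurable.map_map_of_aemeasurable L.continuous.aemeasurable hm, ← hW.law]
  refine Measure.map_congr ?_
  filter_upwards [hW.map_sum_smul (fun i => L (Pi.single i 1)) φ] with ω h
  rw [h, Function.comp_apply]
  refine (LinearMap.pi_apply_eq_sum_univ L.toLinearMap _).trans ?_
  refine Finset.sum_congr rfl fun i _ => ?_
  rw [smul_eq_mul, mul_comm]
  change L _ * _ = L _ * _
  congr 2
  ext j
  simp [Pi.single_apply, eq_comm]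

variable [IsProbabilityMeasure P]

/-- Jointly Gaussian families with vanishing cross-covariances are independent; W(h) is made a
family over `Unit` to fit this criterion. -/
theorem indepFun (hW : IsIsonormal W) {ι : Type*} [Fintype ι] (φ : ι → K) (h : K)
    (hφ : ∀ i, inner ℝ (φ i) h = (0 : ℝ)) : IndepFun (fun ω i => W (φ i) ω) (W h) P := by
  have hg := hW.hasGaussianLaw (Sum.elim φ fun _ : Unit => h)
  have hg2 : HasGaussianLaw (fun ω => (fun i => W (φ i) ω, fun _ : Unit => W h ω)) P :=
    hg.map_fun (E := ι ⊕ Unit → ℝ) (F := (ι → ℝ) × (Unit → ℝ))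
      ((ContinuousLinearMap.pi fun i => ContinuousLinearMap.proj (Sum.inl i)).prod
        (ContinuousLinearMap.pi fun i => ContinuousLinearMap.proj (Sum.inr i)))
  have := hg2.indepFun_of_covariance_eval (X := fun i ω => W (φ i) ω) (Y := fun _ => W h)
    fun i _ => by
      rw [covariance_eq_sub (Lp.memLp _) (Lp.memLp _), hW.integral_eq_zero, zero_mul, sub_zero]
      exact (hW.integral_mul _ _).trans (hφ i)
  exact this.comp (φ := id) (ψ := fun y : Unit → ℝ => y ()) measurable_id (measurable_pi_apply ())

theorem memLp_comp (hW : IsIsonormal W) {ι : Type*} [Fintype ι] {f : (ι → ℝ) → ℝ}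
    (hf : Continuous f) {C : ℝ} (hC : ∀ x, |f x| ≤ C * (1 + ‖x‖)) (φ : ι → K) :
    MemLp (fun ω => f fun i => W (φ i) ω) 2 P := by
  have h1 : MemLp (fun ω => C * (1 + ‖fun i => W (φ i) ω‖)) 2 P :=
    ((memLp_const (1 : ℝ)).add (hW.hasGaussianLaw φ).memLp_two.norm).const_mul C
  have hm : AEMeasurable (fun ω i => W (φ i) ω) P :=
    aemeasurable_pi_lambda _ fun i => aemeasurable W (φ i)
  refine h1.mono (hf.measurable.comp_aemeasurable hm).aestronglyMeasurable
    (Eventually.of_forall fun ω => ?_)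
  exact (hC _).trans (le_abs_self _)

/-- Split φᵢ = ψᵢ + cᵢ h with ψᵢ orthogonal to h. The vector Y of the W(ψᵢ) is independent of the
standard Gaussian W(h), so Fubini reduces the claim to Stein's identity for z ↦ f(y + z c) with y
fixed. -/
theorem integral_mul_of_norm_eq_one (hW : IsIsonormal W) {ι : Type*} [Fintype ι]
    {f : (ι → ℝ) → ℝ} (hf : ContDiff ℝ 1 f) {C : ℝ} (hC : ∀ x, |f x| ≤ C * (1 + ‖x‖))
    (hC' : ∀ x, ‖fderiv ℝ f x‖ ≤ C * (1 + ‖x‖)) (φ : ι → K) {h : K} (hh : ‖h‖ = 1) :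
    ∫ ω, f (fun i => W (φ i) ω) * W h ω ∂P =
      ∫ ω, fderiv ℝ f (fun i => W (φ i) ω) (fun i => inner ℝ (φ i) h) ∂P := by
  set c : ι → ℝ := fun i => inner ℝ (φ i) h with hc
  set ψ : ι → K := fun i => φ i - c i • h with hψ
  set Y : Ω → ι → ℝ := fun ω i => W (ψ i) ω with hY
  have hYm : AEMeasurable Y P := aemeasurable_pi_lambda _ fun i => aemeasurable W (ψ i)
  have hZm := aemeasurable W h
  have hdec : ∀ᵐ ω ∂P, (fun i => W (φ i) ω) = Y ω + W h ω • c := by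
    have : ∀ᵐ ω ∂P, ∀ i, W (φ i) ω = W (ψ i) ω + c i * W h ω := ae_all_iff.2 fun i => by
      have e : W (φ i) = W (ψ i) + c i • W h := by
        rw [← hW.map_smul, ← hW.map_add, hψ]; simp
      filter_upwards [Lp.coeFn_add (W (ψ i)) (c i • W h), Lp.coeFn_smul (c i) (W h)] with ω h1 h2
      rw [e, h1, Pi.add_apply, h2]; simp
    filter_upwards [this] with ω h1
    ext i
    simp [h1 i, Y, mul_comm]
  have hind : IndepFun Y (W h) P := hW.indepFun ψ h fun i => by
    rw [hψ]; simp only [inner_sub_left, real_inner_smul_left, real_inner_self_eq_norm_sq, hh]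
    simp [hc]
  have hmap : P.map (fun ω => (Y ω, W h ω)) = (P.map Y).prod (gaussianReal 0 1) := by
    rw [(indepFun_iff_map_prod_eq_prod_map_map hYm hZm).1 hind, hW.law]
    congr 2
    rw [show ‖h‖₊ = 1 from NNReal.eq hh, one_pow]
  have hprobY : IsProbabilityMeasure (P.map Y) := Measure.isProbabilityMeasure_map hYm
  set G : (ι → ℝ) × ℝ → ℝ := fun p => f (p.1 + p.2 • c) * p.2 with hG
  set G' : (ι → ℝ) × ℝ → ℝ := fun p => fderiv ℝ f (p.1 + p.2 • c) c with hG'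
  have hfd : Continuous (fderiv ℝ f) := hf.continuous_fderiv one_ne_zero
  have hfc := hf.continuous
  have hGc : Continuous G := by fun_prop
  have hG'c : Continuous G' := by fun_prop
  have key : ∀ g : (ι → ℝ) × ℝ → ℝ, Continuous g → Integrable (fun ω => g (Y ω, W h ω)) P →
      ∫ ω, g (Y ω, W h ω) ∂P = ∫ y, ∫ z, g (y, z) ∂(gaussianReal 0 1) ∂(P.map Y) := by
    intro g hg hi
    have h1 : ∫ ω, g (Y ω, W h ω) ∂P = ∫ p, g p ∂(P.map fun ω => (Y ω, W h ω)) :=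
      (integral_map (hYm.prodMk hZm) hg.aestronglyMeasurable).symm
    rw [h1, hmap, integral_prod]
    rw [← hmap]
    exact (integrable_map_measure hg.aestronglyMeasurable (hYm.prodMk hZm)).2 hi
  have e1 : ∫ ω, f (fun i => W (φ i) ω) * W h ω ∂P = ∫ ω, G (Y ω, W h ω) ∂P :=
    integral_congr_ae (by filter_upwards [hdec] with ω h1; rw [h1])
  have e2 : ∫ ω, fderiv ℝ f (fun i => W (φ i) ω) c ∂P = ∫ ω, G' (Y ω, W h ω) ∂P :=
    integral_congr_ae (by filter_upwards [hdec] with ω h1; rw [h1])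
  rw [e1, e2, key G hGc, key G' hG'c]
  · congr 1
    ext y
    have hC0 : 0 ≤ C := by
      have := (abs_nonneg _).trans (hC 0)
      simpa using this
    have hb : ∀ z : ℝ, 1 + ‖y + z • c‖ ≤ (1 + ‖y‖ + ‖c‖) * (1 + |z|) := fun z => by
      have h1 := norm_add_le y (z • c)
      rw [norm_smul, Real.norm_eq_abs] at h1
      nlinarith [norm_nonneg y, norm_nonneg c, abs_nonneg z, mul_nonneg (norm_nonneg y) (abs_nonneg z)]
    -- The constant may depend on the frozen y. The last factor 1 + ‖c‖ serves both bounds: it is at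
    -- least 1 for the function and at least ‖c‖ for its derivative in the direction c.
    refine integral_mul_id_gaussianReal (g := fun z => f (y + z • c))
      (g' := fun z => fderiv ℝ f (y + z • c) c) (fun z => ?_) (by fun_prop)
      (C := C * (1 + ‖y‖ + ‖c‖) * (1 + ‖c‖)) (fun z => ?_) (fun z => ?_)
    · have h1 : HasDerivAt (fun z : ℝ => y + z • c) c z := by
        simpa using ((hasDerivAt_id z).smul_const c).const_add y
      exact ((hf.differentiable one_ne_zero) _).hasFDerivAt.comp_hasDerivAt z h1
    · calc |f (y + z • c)| ≤ C * (1 + ‖y + z • c‖) := hC _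
        _ ≤ C * ((1 + ‖y‖ + ‖c‖) * (1 + |z|)) := by gcongr; exact hb z
        _ = (C * ((1 + ‖y‖ + ‖c‖) * (1 + |z|))) * 1 := by ring
        _ ≤ (C * ((1 + ‖y‖ + ‖c‖) * (1 + |z|))) * (1 + ‖c‖) := by
          gcongr; linarith [norm_nonneg c]
        _ = _ := by ring
    · calc |fderiv ℝ f (y + z • c) c| ≤ ‖fderiv ℝ f (y + z • c)‖ * ‖c‖ :=
            (fderiv ℝ f _).le_opNorm c
        _ ≤ (C * (1 + ‖y + z • c‖)) * ‖c‖ := by gcongr; exact hC' _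
        _ ≤ (C * ((1 + ‖y‖ + ‖c‖) * (1 + |z|))) * (1 + ‖c‖) := by
          gcongr
          · exact hb z
          · linarith
        _ = _ := by ring
  · have h1 : MemLp (fun ω => fderiv ℝ f (fun i => W (φ i) ω) c) 2 P :=
      hW.memLp_comp (f := fun x => fderiv ℝ f x c) (by fun_prop) (C := C * ‖c‖) (fun x => by
        calc |fderiv ℝ f x c| ≤ ‖fderiv ℝ f x‖ * ‖c‖ := (fderiv ℝ f x).le_opNorm c
          _ ≤ (C * (1 + ‖x‖)) * ‖c‖ := by gcongr; exact hC' _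
          _ = _ := by ring) φ
    exact (h1.integrable one_le_two).congr (by filter_upwards [hdec] with ω h1; rw [h1])
  · have h1 : Integrable (fun ω => f (fun i => W (φ i) ω) * W h ω) P :=
      (hW.memLp_comp hfc hC φ).integrable_mul (Lp.memLp (W h))
    exact h1.congr (by filter_upwards [hdec] with ω h1; rw [h1])

/-- Gaussian integration by parts. -/
theorem integral_mul_eq_integral_fderiv (hW : IsIsonormal W) {ι : Type*} [Fintype ι]
    {f : (ι → ℝ) → ℝ} (hf : ContDiff ℝ 1 f) {C : ℝ} (hC : ∀ x, |f x| ≤ C * (1 + ‖x‖))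
    (hC' : ∀ x, ‖fderiv ℝ f x‖ ≤ C * (1 + ‖x‖)) (φ : ι → K) (h : K) :
    ∫ ω, f (fun i => W (φ i) ω) * W h ω ∂P =
      ∫ ω, fderiv ℝ f (fun i => W (φ i) ω) (fun i => inner ℝ (φ i) h) ∂P := by
  -- Normalizing h divides by ‖h‖, so h = 0 is treated apart; both sides vanish there.
  rcases eq_or_ne h 0 with rfl | hh
  · have h0 : W 0 = 0 := hW.toLinearMap.map_zero
    have h1 : (fun i => inner ℝ (φ i) (0 : K)) = (0 : ι → ℝ) := by ext i; simp
    rw [h0, h1]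
    simp only [map_zero, integral_zero]
    refine integral_eq_zero_of_ae ?_
    filter_upwards [Lp.coeFn_zero ℝ 2 P] with ω h2
    simp
  · have hn : ‖h‖ ≠ 0 := norm_ne_zero_iff.2 hh
    have key := hW.integral_mul_of_norm_eq_one hf hC hC' φ (h := ‖h‖⁻¹ • h)
      (by rw [norm_smul, norm_inv, norm_norm, inv_mul_cancel₀ hn])
    have e1 : (fun i => inner ℝ (φ i) (‖h‖⁻¹ • h) : ι → ℝ) = ‖h‖⁻¹ • fun i => inner ℝ (φ i) h := by
      ext i; simp [real_inner_smul_right]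
    have e2 : ∫ ω, f (fun i => W (φ i) ω) * W (‖h‖⁻¹ • h) ω ∂P =
        ‖h‖⁻¹ * ∫ ω, f (fun i => W (φ i) ω) * W h ω ∂P := by
      rw [← integral_const_mul]
      refine integral_congr_ae ?_
      rw [hW.map_smul]
      filter_upwards [Lp.coeFn_smul ‖h‖⁻¹ (W h)] with ω h2
      rw [h2]; simp; ring
    rw [e1, e2] at key
    simp only [_root_.map_smul, smul_eq_mul, integral_const_mul] at key
    exact mul_left_cancel₀ (inv_ne_zero hn) key

end IsIsonormal

end


/-! ### Calculus of cylindrical random variables -/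

section

theorem isCbSmooth_comp {n : ℕ} {E : Type*} [NormedAddCommGroup E] [NormedSpace ℝ E] {f : E → ℝ}
    (hf : ContDiff ℝ (⊤ : ℕ∞) f) (hb : ∀ m : ℕ, ∃ C : ℝ, ∀ x, ‖iteratedFDeriv ℝ m f x‖ ≤ C)
    (L : (Fin n → ℝ) →L[ℝ] E) : IsCbSmooth fun x => f (L x) := by
  refine ⟨hf.comp L.contDiff, fun m => ?_⟩
  obtain ⟨C, hC⟩ := hb m
  refine ⟨C * ∏ _i : Fin m, ‖L‖, fun x => ?_⟩
  change ‖iteratedFDeriv ℝ m (f ∘ L) x‖ ≤ _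
  rw [L.iteratedFDeriv_comp_right hf x (by exact_mod_cast le_top)]
  refine (ContinuousMultilinearMap.norm_compContinuousLinearMap_le _ _).trans ?_
  gcongr
  exact hC _

theorem IsCbSmooth.comp_clm {n m : ℕ} {f : (Fin m → ℝ) → ℝ} (hf : IsCbSmooth f)
    (L : (Fin n → ℝ) →L[ℝ] Fin m → ℝ) : IsCbSmooth fun x => f (L x) :=
  isCbSmooth_comp hf.1 hf.2 L

theorem IsCbSmooth.const_mul {n : ℕ} {f : (Fin n → ℝ) → ℝ} (hf : IsCbSmooth f) (c : ℝ) :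
    IsCbSmooth fun x => c * f x := by
  refine ⟨contDiff_const.mul hf.1, fun m => ?_⟩
  obtain ⟨C, hC⟩ := hf.2 m
  refine ⟨‖c‖ * C, fun x => ?_⟩
  have h := ((ContinuousLinearMap.mul ℝ ℝ) c).norm_iteratedFDeriv_comp_left (n := m)
    (hf.1.contDiffAt (x := x)) (by exact_mod_cast le_top)
  refine h.trans ?_
  gcongr
  · exact ContinuousLinearMap.opNorm_mul_apply_le ℝ ℝ c
  · exact hC x

theorem IsCbSmooth.mul {n : ℕ} {f g : (Fin n → ℝ) → ℝ} (hf : IsCbSmooth f) (hg : IsCbSmooth g) :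
    IsCbSmooth fun x => f x * g x := by
  refine ⟨hf.1.mul hg.1, fun m => ?_⟩
  choose C hC using hf.2
  choose D hD using hg.2
  refine ⟨∑ i ∈ Finset.range (m + 1), (m.choose i : ℝ) * C i * D (m - i), fun x => ?_⟩
  refine (norm_iteratedFDeriv_mul_le hf.1 hg.1 x (by exact_mod_cast le_top)).trans
    (Finset.sum_le_sum fun i _ => ?_)
  have h0 : 0 ≤ C i := (norm_nonneg _).trans (hC i x)
  gcongr
  · exact hC i x
  · exact hD _ x

theorem IsCbSmooth.fderiv_apply {n : ℕ} {f : (Fin n → ℝ) → ℝ} (hf : IsCbSmooth f)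
    (c : Fin n → ℝ) : IsCbSmooth fun x => fderiv ℝ f x c := by
  have hd : ContDiff ℝ (⊤ : ℕ∞) (fderiv ℝ f) := hf.1.fderiv_right (by simp)
  refine ⟨hd.clm_apply contDiff_const, fun m => ?_⟩
  obtain ⟨C, hC⟩ := hf.2 (m + 1)
  refine ⟨‖ContinuousLinearMap.apply ℝ ℝ c‖ * C, fun x => ?_⟩
  refine ((ContinuousLinearMap.apply ℝ ℝ c).norm_iteratedFDeriv_comp_left (n := m)
    (hd.contDiffAt (x := x)) (by exact_mod_cast le_top)).trans ?_
  gcongr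
  rw [norm_iteratedFDeriv_fderiv]
  exact hC x

theorem isCbSmooth_sin {n : ℕ} (L : (Fin n → ℝ) →L[ℝ] ℝ) :
    IsCbSmooth fun x => Real.sin (L x) :=
  isCbSmooth_comp Real.contDiff_sin (fun m => ⟨1, fun x => by
    rw [norm_iteratedFDeriv_eq_norm_iteratedDeriv]
    exact Real.abs_iteratedDeriv_sin_le_one m x⟩) L

theorem IsCbSmooth.bounds {n : ℕ} {f : (Fin n → ℝ) → ℝ} (hf : IsCbSmooth f) :
    ∃ C : ℝ, (∀ x, |f x| ≤ C) ∧ ∀ x, ‖fderiv ℝ f x‖ ≤ C := by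
  obtain ⟨C, hC⟩ := hf.2 0
  obtain ⟨D, hD⟩ := hf.2 1
  refine ⟨max C D, fun x => ?_, fun x => ?_⟩
  · have := hC x
    rw [norm_iteratedFDeriv_zero] at this
    exact this.trans (le_max_left _ _)
  · have := hD x
    rw [← norm_iteratedFDeriv_fderiv, norm_iteratedFDeriv_zero] at this
    exact this.trans (le_max_right _ _)

variable {Ω : Type*} [MeasurableSpace Ω] {P : Measure Ω}
variable {K : Type*} [NormedAddCommGroup K] [InnerProductSpace ℝ K]

/-- The vector `∑ᵢ L(eᵢ) φᵢ` for a linear form `L` on `ℝ^ι`. -/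
def gradComb {ι : Type*} [Fintype ι] [DecidableEq ι] (φ : ι → K) (L : (ι → ℝ) →L[ℝ] ℝ) : K :=
  ∑ i, L (Pi.single i 1) • φ i

/-- Pairing the gradient with v is differentiation in the direction (⟨φᵢ, v⟩)ᵢ, the form in which
Gaussian integration by parts delivers it. -/
theorem inner_gradComb {ι : Type*} [Fintype ι] [DecidableEq ι] (φ : ι → K)
    (L : (ι → ℝ) →L[ℝ] ℝ) (v : K) :
    inner ℝ (gradComb φ L) v = L fun i => inner ℝ (φ i) v := by
  rw [gradComb, sum_inner]
  refine .trans ?_ (LinearMap.pi_apply_eq_sum_univ L.toLinearMap _).symm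
  refine Finset.sum_congr rfl fun i _ => ?_
  rw [real_inner_smul_left, smul_eq_mul, mul_comm]
  congr 1
  change L _ = L _
  congr 1
  ext j
  simp [Pi.single_apply, eq_comm]

/-- `F` is a `C¹` function of linear growth, with derivative of linear growth, of finitely many
`W(φᵢ)`, and `D` is its derivative. -/
def IsCyl (W : K → Lp ℝ 2 P) (F : Ω → ℝ) (D : Ω → K) : Prop :=
  ∃ (ι : Type) (_ : Fintype ι) (_ : DecidableEq ι) (f : (ι → ℝ) → ℝ) (φ : ι → K) (C : ℝ),
    ContDiff ℝ 1 f ∧ (∀ x, |f x| ≤ C * (1 + ‖x‖)) ∧ (∀ x, ‖fderiv ℝ f x‖ ≤ C * (1 + ‖x‖)) ∧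
    (F = fun ω => f fun i => W (φ i) ω) ∧
    D = fun ω => gradComb φ (fderiv ℝ f fun i => W (φ i) ω)

/-- `F` is a bounded `C¹` function with bounded derivative of finitely many `W(φᵢ)`, and `D` is
its derivative. -/
def IsBddCyl (W : K → Lp ℝ 2 P) (F : Ω → ℝ) (D : Ω → K) : Prop :=
  ∃ (ι : Type) (_ : Fintype ι) (_ : DecidableEq ι) (f : (ι → ℝ) → ℝ) (φ : ι → K) (C : ℝ),
    ContDiff ℝ 1 f ∧ (∀ x, |f x| ≤ C) ∧ (∀ x, ‖fderiv ℝ f x‖ ≤ C) ∧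
    (F = fun ω => f fun i => W (φ i) ω) ∧
    D = fun ω => gradComb φ (fderiv ℝ f fun i => W (φ i) ω)

/-- `F` is a bounded smooth function with bounded derivatives of finitely many `W(φᵢ)`, and `D` is
its derivative. -/
def IsSmoothCyl (W : K → Lp ℝ 2 P) (F : Ω → ℝ) (D : Ω → K) : Prop :=
  ∃ (n : ℕ) (f : (Fin n → ℝ) → ℝ) (φ : Fin n → K), 1 ≤ n ∧ IsCbSmooth f ∧
    (F = fun ω => f fun i => W (φ i) ω) ∧
    D = fun ω => gradComb φ (fderiv ℝ f fun i => W (φ i) ω)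

variable {W : K → Lp ℝ 2 P} {F G : Ω → ℝ} {D E : Ω → K}

theorem mem_smoothPairs_iff {p : Lp ℝ 2 P × Lp K 2 P} :
    p ∈ smoothPairs W ↔ ∃ F D, IsSmoothCyl W F D ∧ p.1 =ᵐ[P] F ∧ p.2 =ᵐ[P] D := by
  constructor
  · rintro ⟨n, f, φ, hn, hf, h1, h2⟩
    exact ⟨_, _, ⟨n, f, φ, hn, hf, rfl, rfl⟩, h1, h2⟩
  · rintro ⟨_, _, ⟨n, f, φ, hn, hf, rfl, rfl⟩, h1, h2⟩
    exact ⟨n, f, φ, hn, hf, h1, h2⟩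

theorem IsSmoothCyl.isBddCyl (h : IsSmoothCyl W F D) : IsBddCyl W F D := by
  obtain ⟨n, f, φ, -, hf, h1, h2⟩ := h
  obtain ⟨C, hC, hC'⟩ := hf.bounds
  exact ⟨Fin n, inferInstance, inferInstance, f, φ, C, hf.1.of_le (by exact_mod_cast le_top),
    hC, hC', h1, h2⟩

theorem IsBddCyl.isCyl (h : IsBddCyl W F D) : IsCyl W F D := by
  obtain ⟨ι, _, _, f, φ, C, hf, hC, hC', h1, h2⟩ := h
  have hC0 : 0 ≤ C := (abs_nonneg _).trans (hC 0)
  have hx : ∀ x : ι → ℝ, C ≤ C * (1 + ‖x‖) := fun x =>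
    le_mul_of_one_le_right hC0 (by linarith [norm_nonneg x])
  exact ⟨ι, inferInstance, inferInstance, f, φ, C, hf, fun x => (hC x).trans (hx x),
    fun x => (hC' x).trans (hx x), h1, h2⟩

theorem isCyl_self (W : K → Lp ℝ 2 P) (v : K) : IsCyl W (W v) fun _ => v := by
  have hd : ∀ x, fderiv ℝ (fun x : Unit → ℝ => x ()) x =
      ContinuousLinearMap.proj (R := ℝ) (φ := fun _ : Unit => ℝ) () := fun x =>
    (ContinuousLinearMap.proj (R := ℝ) (φ := fun _ : Unit => ℝ) ()).fderiv
  refine ⟨Unit, inferInstance, inferInstance, fun x => x (), fun _ => v, 1,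
    contDiff_apply ℝ ℝ (), fun x => ?_, fun x => ?_, rfl, ?_⟩
  · have := norm_le_pi_norm x ()
    rw [Real.norm_eq_abs] at this
    linarith
  · rw [hd]
    have : ‖ContinuousLinearMap.proj (R := ℝ) (φ := fun _ : Unit => ℝ) ()‖ ≤ 1 :=
      ContinuousLinearMap.opNorm_le_bound _ zero_le_one fun x => by
        rw [one_mul]; exact norm_le_pi_norm x ()
    linarith [norm_nonneg x]
  · ext ω
    rw [hd]
    simp [gradComb]

theorem gradComb_add {ι : Type*} [Fintype ι] [DecidableEq ι] (φ : ι → K)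
    (L M : (ι → ℝ) →L[ℝ] ℝ) : gradComb φ (L + M) = gradComb φ L + gradComb φ M := by
  simp [gradComb, add_smul, Finset.sum_add_distrib]

theorem gradComb_smul {ι : Type*} [Fintype ι] [DecidableEq ι] (φ : ι → K) (c : ℝ)
    (L : (ι → ℝ) →L[ℝ] ℝ) : gradComb φ (c • L) = c • gradComb φ L := by
  simp [gradComb, mul_smul, Finset.smul_sum]

/-- Restriction of the coordinates along `a`. -/
noncomputable def restrictCoords {ι κ : Type*} (a : ι → κ) : (κ → ℝ) →L[ℝ] ι → ℝ :=
  ContinuousLinearMap.pi fun i => ContinuousLinearMap.proj (a i)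

@[simp] theorem restrictCoords_apply {ι κ : Type*} (a : ι → κ) (x : κ → ℝ) :
    restrictCoords a x = fun i => x (a i) := rfl

theorem norm_restrictCoords_apply_le {ι κ : Type*} [Fintype ι] [Fintype κ] (a : ι → κ)
    (x : κ → ℝ) : ‖restrictCoords a x‖ ≤ ‖x‖ :=
  (pi_norm_le_iff_of_nonneg (norm_nonneg _)).2 fun i => norm_le_pi_norm x (a i)

theorem norm_restrictCoords_le {ι κ : Type*} [Fintype ι] [Fintype κ] (a : ι → κ) :
    ‖restrictCoords a‖ ≤ 1 :=
  ContinuousLinearMap.opNorm_le_bound _ zero_le_one fun x => by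
    rw [one_mul]; exact norm_restrictCoords_apply_le a x

theorem fderiv_mul_restrictCoords {ι κ τ : Type*} [Fintype ι] [Fintype κ] [Fintype τ] {f : (ι → ℝ) → ℝ}
    {g : (κ → ℝ) → ℝ} (hf : Differentiable ℝ f) (hg : Differentiable ℝ g) (a : ι → τ) (b : κ → τ)
    (x : τ → ℝ) :
    fderiv ℝ (fun x => f (restrictCoords a x) * g (restrictCoords b x)) x =
      f (restrictCoords a x) • (fderiv ℝ g (restrictCoords b x)).comp (restrictCoords b) +
      g (restrictCoords b x) • (fderiv ℝ f (restrictCoords a x)).comp (restrictCoords a) := by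
  have h1 : HasFDerivAt (fun x => f (restrictCoords a x)) _ x :=
    (hf _).hasFDerivAt.comp x (restrictCoords a).hasFDerivAt
  have h2 : HasFDerivAt (fun x => g (restrictCoords b x)) _ x :=
    (hg _).hasFDerivAt.comp x (restrictCoords b).hasFDerivAt
  exact (h1.mul h2).fderiv

/-- Coordinates outside the image of `a` contribute nothing, and injectivity makes the unit vector
at a(i) restrict to the one at i. This lets two cylindrical variables be placed on one disjoint
index set. -/
theorem gradComb_comp_restrictCoords {ι τ : Type*} [Fintype ι] [Fintype τ] [DecidableEq ι]
    [DecidableEq τ] {a : ι → τ} (ha : Function.Injective a) (φ : τ → K) (L : (ι → ℝ) →L[ℝ] ℝ) :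
    gradComb φ (L.comp (restrictCoords a)) = gradComb (fun i => φ (a i)) L := by
  unfold gradComb
  rw [← Finset.sum_subset (Finset.subset_univ (Finset.univ.image a)),
    Finset.sum_image fun i _ j _ h => ha h]
  · refine Finset.sum_congr rfl fun i _ => ?_
    congr 1
    change L _ = L _
    congr 1
    ext j
    simp [Pi.single_apply, ha.eq_iff]
  · intro t _ ht
    have : restrictCoords a (Pi.single t 1) = 0 := by
      ext j
      have : a j ≠ t := fun h => ht (Finset.mem_image.2 ⟨j, Finset.mem_univ _, h⟩)
      simp [this]
    rw [ContinuousLinearMap.comp_apply, this, map_zero, zero_smul]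

/-- Linear growth is preserved because one factor is bounded with bounded derivative; two factors of
linear growth would leave the class. This is what makes F W(v) and F G W(v) admissible in the
integration by parts. -/
theorem IsBddCyl.mul (hF : IsBddCyl W F D) (hG : IsCyl W G E) :
    IsCyl W (fun ω => F ω * G ω) fun ω => F ω • E ω + G ω • D ω := by
  obtain ⟨ι, _, _, f, φ, C, hf, hC, hC', rfl, rfl⟩ := hF
  obtain ⟨κ, _, _, g, ψ, B, hg, hB, hB', rfl, rfl⟩ := hG
  have hC0 : 0 ≤ C := (abs_nonneg _).trans (hC 0)
  have hB0 : 0 ≤ B := by simpa using (abs_nonneg _).trans (hB 0)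
  have hfd := hf.differentiable one_ne_zero
  have hgd := hg.differentiable one_ne_zero
  have hr : ∀ x : ι ⊕ κ → ℝ, B * (1 + ‖restrictCoords (Sum.inr (α := ι)) x‖) ≤ B * (1 + ‖x‖) :=
    fun x => by gcongr; exact norm_restrictCoords_apply_le _ _
  -- The factor 2 accounts for the two terms of the product rule, each at most C B (1 + ‖x‖).
  refine ⟨ι ⊕ κ, inferInstance, inferInstance,
    fun x => f (restrictCoords Sum.inl x) * g (restrictCoords Sum.inr x), Sum.elim φ ψ,
    2 * (C * B), ?_, fun x => ?_, fun x => ?_, rfl, ?_⟩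
  · exact (hf.comp (restrictCoords (Sum.inl (β := κ))).contDiff).mul
      (hg.comp (restrictCoords (Sum.inr (α := ι))).contDiff)
  · rw [abs_mul]
    calc _ ≤ C * (B * (1 + ‖x‖)) := by
          gcongr
          · exact hC _
          · exact (hB _).trans (hr x)
      _ ≤ _ := by
          have : 0 ≤ C * (B * (1 + ‖x‖)) := by positivity
          linarith
  · rw [fderiv_mul_restrictCoords hfd hgd]
    refine (norm_add_le _ _).trans ?_
    rw [norm_smul, norm_smul]
    have h1 : ‖(fderiv ℝ g (restrictCoords (Sum.inr (α := ι)) x)).comp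
        (restrictCoords (Sum.inr (α := ι)))‖ ≤ B * (1 + ‖x‖) := by
      refine (ContinuousLinearMap.opNorm_comp_le _ _).trans ?_
      refine (mul_le_of_le_one_right (norm_nonneg _) (norm_restrictCoords_le _)).trans ?_
      exact (hB' _).trans (hr x)
    have h2 : ‖(fderiv ℝ f (restrictCoords (Sum.inl (β := κ)) x)).comp
        (restrictCoords (Sum.inl (β := κ)))‖ ≤ C := by
      refine (ContinuousLinearMap.opNorm_comp_le _ _).trans ?_
      refine (mul_le_of_le_one_right (norm_nonneg _) (norm_restrictCoords_le _)).trans ?_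
      exact hC' _
    calc _ ≤ C * (B * (1 + ‖x‖)) + (B * (1 + ‖x‖)) * C := by
          refine add_le_add (mul_le_mul (hC _) h1 (norm_nonneg _) hC0)
            (mul_le_mul ((hB _).trans (hr x)) h2 (norm_nonneg _) (by positivity))
      _ = _ := by ring
  · ext ω
    rw [fderiv_mul_restrictCoords hfd hgd, gradComb_add, gradComb_smul, gradComb_smul,
      gradComb_comp_restrictCoords Sum.inl_injective, gradComb_comp_restrictCoords Sum.inr_injective]
    rfl

theorem IsSmoothCyl.mul (hF : IsSmoothCyl W F D) (hG : IsSmoothCyl W G E) :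
    IsSmoothCyl W (fun ω => F ω * G ω) fun ω => F ω • E ω + G ω • D ω := by
  obtain ⟨n, f, φ, hn, hf, rfl, rfl⟩ := hF
  obtain ⟨m, g, ψ, hm, hg, rfl, rfl⟩ := hG
  have hl : Function.Injective (Fin.castAdd m : Fin n → Fin (n + m)) := Fin.castAdd_injective n m
  have hr : Function.Injective (Fin.natAdd n : Fin m → Fin (n + m)) := Fin.natAdd_injective m n
  refine ⟨n + m, fun x => f (restrictCoords (Fin.castAdd m) x) *
    g (restrictCoords (Fin.natAdd n) x), Fin.append φ ψ, by omega,
    (hf.comp_clm _).mul (hg.comp_clm _), ?_, ?_⟩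
  · ext ω; simp
  · ext ω
    rw [fderiv_mul_restrictCoords (hf.1.differentiable (by simp)) (hg.1.differentiable (by simp)),
      gradComb_add, gradComb_smul, gradComb_smul, gradComb_comp_restrictCoords hl,
      gradComb_comp_restrictCoords hr]
    simp

/-- Bounded smooth substitutes for W(v): they are dominated by |W(v)| and tend to it as c → 0
through nonzero values. -/
theorem isSmoothCyl_sin (W : K → Lp ℝ 2 P) (v : K) (c : ℝ) :
    ∃ D, IsSmoothCyl W (fun ω => c⁻¹ * Real.sin (c * W v ω)) D :=
  ⟨_, 1, fun x => c⁻¹ * Real.sin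
    ((c • ContinuousLinearMap.proj (R := ℝ) (φ := fun _ : Fin 1 => ℝ) 0) x), fun _ => v, le_rfl,
    (isCbSmooth_sin _).const_mul _, rfl, rfl⟩

/-- The second derivative of a smooth cylindrical random variable, which is symmetric. -/
theorem IsSmoothCyl.exists_second (hF : IsSmoothCyl W F D) :
    ∃ D2 : K → Ω → K, (∀ v, IsSmoothCyl W (fun ω => inner ℝ (D ω) v) (D2 v)) ∧
      ∀ v w ω, inner ℝ (D2 v ω) w = (inner ℝ (D2 w ω) v : ℝ) := by
  obtain ⟨n, f, φ, hn, hf, rfl, rfl⟩ := hF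
  have hd : Differentiable ℝ (fderiv ℝ f) :=
    (hf.1.fderiv_right (m := (⊤ : ℕ∞)) (by simp)).differentiable (by simp)
  refine ⟨fun v ω => gradComb φ (fderiv ℝ (fun x => fderiv ℝ f x fun i => inner ℝ (φ i) v)
    fun i => W (φ i) ω), fun v => ⟨n, _, φ, hn, hf.fderiv_apply _, ?_, rfl⟩, fun v w ω => ?_⟩
  · ext ω
    rw [inner_gradComb]
  -- Both sides are the second derivative of f at the same point on the same two vectors, in
  -- opposite orders.
  · have key : ∀ (c : Fin n → ℝ) (x d : Fin n → ℝ), fderiv ℝ (fun x => fderiv ℝ f x c) x d =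
        fderiv ℝ (fderiv ℝ f) x d c := fun c x d => by
      rw [((hd x).hasFDerivAt.clm_apply (hasFDerivAt_const c x)).fderiv]
      simp
    rw [inner_gradComb, inner_gradComb, key, key]
    exact (hf.1.contDiffAt.isSymmSndFDerivAt
      (by simpa using (WithTop.coe_le_coe.2 le_top : ((2 : ℕ∞) : WithTop ℕ∞) ≤ _))) _ _

theorem IsCyl.memLp [IsProbabilityMeasure P] (hW : IsIsonormal W) (hF : IsCyl W F D) :
    MemLp F 2 P := by
  obtain ⟨ι, _, _, f, φ, C, hf, hC, hC', rfl, rfl⟩ := hF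
  exact hW.memLp_comp hf.continuous hC φ

theorem IsBddCyl.memLp_grad [IsProbabilityMeasure P] (hF : IsBddCyl W F D) : MemLp D 2 P := by
  obtain ⟨ι, _, _, f, φ, C, hf, hC, hC', rfl, rfl⟩ := hF
  have hm : AEMeasurable (fun ω i => W (φ i) ω) P :=
    aemeasurable_pi_lambda _ fun i => IsIsonormal.aemeasurable W (φ i)
  have hd : Continuous (fderiv ℝ f) := hf.continuous_fderiv one_ne_zero
  refine memLp_finsetSum _ fun i _ => ?_
  refine MemLp.of_bound (C := C * ‖(Pi.single i 1 : ι → ℝ)‖ * ‖φ i‖) ?_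
    (Eventually.of_forall fun ω => ?_)
  · have h1 : Continuous fun x => fderiv ℝ f x (Pi.single i 1) := by fun_prop
    exact (h1.measurable.comp_aemeasurable hm).aestronglyMeasurable.smul_const _
  · rw [norm_smul]
    gcongr
    exact ((fderiv ℝ f _).le_opNorm _).trans (by gcongr; exact hC' _)

theorem IsCyl.integral_mul [IsProbabilityMeasure P] (hW : IsIsonormal W) (hF : IsCyl W F D)
    (v : K) : ∫ ω, F ω * W v ω ∂P = ∫ ω, inner ℝ (D ω) v ∂P := by
  obtain ⟨ι, _, _, f, φ, C, hf, hC, hC', rfl, rfl⟩ := hF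
  simp only [inner_gradComb]
  exact hW.integral_mul_eq_integral_fderiv hf hC hC' φ v

end


/-! ### The graph of the Skorohod integral -/

section

variable {Ω : Type*} [MeasurableSpace Ω] {P : Measure Ω}
variable {K : Type*} [NormedAddCommGroup K] [InnerProductSpace ℝ K]
variable {W : K → Lp ℝ 2 P} {F G : Ω → ℝ} {D E : Ω → K}

theorem IsSmoothCyl.memLp_inner [IsProbabilityMeasure P] (hW : IsIsonormal W)
    (hF : IsSmoothCyl W F D) (v : K) : MemLp (fun ω => inner ℝ (D ω) v) 2 P := by
  obtain ⟨D2, h, -⟩ := hF.exists_second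
  exact (h v).isBddCyl.isCyl.memLp hW

theorem IsSmoothCyl.memLp_mul [IsProbabilityMeasure P] (hW : IsIsonormal W)
    (hF : IsSmoothCyl W F D) (v : K) : MemLp (fun ω => F ω * W v ω) 2 P :=
  (hF.isBddCyl.mul (isCyl_self W v)).memLp hW

/-- The duality between `D` and the Skorohod integral of `G v`. -/
theorem IsSmoothCyl.integral_mul_divergence [IsProbabilityMeasure P] (hW : IsIsonormal W)
    (hF : IsSmoothCyl W F D) (hG : IsSmoothCyl W G E) (v : K) :
    ∫ ω, F ω * (G ω * W v ω - inner ℝ (E ω) v) ∂P = ∫ ω, G ω * inner ℝ (D ω) v ∂P := by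
  -- Integration by parts for the product F G; the term containing the derivative of G is then moved
  -- to the other side.
  have h1 := (hF.isBddCyl.mul hG.isBddCyl.isCyl).integral_mul hW v
  have mF := hF.isBddCyl.isCyl.memLp hW
  have mG := hG.isBddCyl.isCyl.memLp hW
  have i1 : Integrable (fun ω => F ω * (G ω * W v ω)) P := mF.integrable_mul (hG.memLp_mul hW v)
  have i2 : Integrable (fun ω => F ω * inner ℝ (E ω) v) P :=
    mF.integrable_mul (hG.memLp_inner hW v)
  have i3 : Integrable (fun ω => G ω * inner ℝ (D ω) v) P :=
    mG.integrable_mul (hF.memLp_inner hW v)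
  simp only [inner_add_left, real_inner_smul_left] at h1
  rw [integral_add i2 i3] at h1
  simp only [mul_sub]
  rw [integral_sub i1 i2, sub_eq_iff_eq_add', ← h1]
  simp only [mul_assoc]

/-- The energy identity for the Skorohod integrals of `F v` and `G w`. -/
theorem IsSmoothCyl.integral_divergence_mul_divergence [IsProbabilityMeasure P]
    (hW : IsIsonormal W) (hF : IsSmoothCyl W F D) (hG : IsSmoothCyl W G E) (v w : K) :
    ∫ ω, (F ω * W v ω - inner ℝ (D ω) v) * (G ω * W w ω - inner ℝ (E ω) w) ∂P =
      ∫ ω, F ω * G ω * inner ℝ v w ∂P + ∫ ω, inner ℝ (D ω) w * inner ℝ (E ω) v ∂P := by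
  obtain ⟨D2, hD2, hsymm⟩ := hF.exists_second
  have mF := hF.isBddCyl.isCyl.memLp hW
  have mG := hG.isBddCyl.isCyl.memLp hW
  have mW := fun v => Lp.memLp (W v)
  have cGv := hG.isBddCyl.mul (isCyl_self W v)
  have cFGv := hF.isBddCyl.mul cGv
  have i1 : Integrable (fun ω => F ω * (G ω * W v ω) * W w ω) P :=
    (cFGv.memLp hW).integrable_mul (mW w)
  have i2 : Integrable (fun ω => F ω * W v ω * inner ℝ (E ω) w) P :=
    (hF.memLp_mul hW v).integrable_mul (hG.memLp_inner hW w)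
  have i3 : ∀ v w, Integrable (fun ω => G ω * inner ℝ (D ω) v * W w ω) P := fun v w =>
    ((hG.isBddCyl.mul (hD2 v).isBddCyl.isCyl).memLp hW).integrable_mul (mW w)
  have i4 : ∀ v w, Integrable (fun ω => inner ℝ (D ω) v * inner ℝ (E ω) w) P := fun v w =>
    (hF.memLp_inner hW v).integrable_mul (hG.memLp_inner hW w)
  have i5 : Integrable (fun ω => F ω * G ω * inner ℝ v w) P := (mF.integrable_mul mG).mul_const _
  have i6 : ∀ v w, Integrable (fun ω => G ω * inner ℝ (D2 v ω) w) P := fun v w =>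
    mG.integrable_mul ((hD2 v).memLp_inner hW w)
  -- W(w) is integrated away. Of the three resulting terms the second cancels against one in `e4`,
  -- and the third still contains W(v).
  have e1 : ∫ ω, F ω * (G ω * W v ω) * W w ω ∂P = ∫ ω, F ω * G ω * inner ℝ v w ∂P +
      ∫ ω, F ω * W v ω * inner ℝ (E ω) w ∂P + ∫ ω, G ω * inner ℝ (D ω) w * W v ω ∂P := by
    rw [cFGv.integral_mul hW w, ← integral_add i5 i2, ← integral_add ?_ (i3 w v)]
    swap
    · exact i5.add i2
    refine integral_congr_ae (Eventually.of_forall fun ω => ?_)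
    simp only [inner_add_left, real_inner_smul_left]
    ring
  -- Needed for (v, w) and for (w, v): the second derivatives of F cancel in the difference, by
  -- their symmetry.
  have e2 : ∀ v w, ∫ ω, G ω * inner ℝ (D ω) v * W w ω ∂P =
      ∫ ω, G ω * inner ℝ (D2 v ω) w ∂P + ∫ ω, inner ℝ (D ω) v * inner ℝ (E ω) w ∂P := by
    intro v w
    rw [(hG.isBddCyl.mul (hD2 v).isBddCyl.isCyl).integral_mul hW w, ← integral_add (i6 v w) (i4 v w)]
    refine integral_congr_ae (Eventually.of_forall fun ω => ?_)
    simp only [inner_add_left, real_inner_smul_left]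
  have e3 : ∫ ω, G ω * inner ℝ (D2 w ω) v ∂P = ∫ ω, G ω * inner ℝ (D2 v ω) w ∂P := by
    simp only [hsymm w v]
  have e4 : ∫ ω, (F ω * W v ω - inner ℝ (D ω) v) * (G ω * W w ω - inner ℝ (E ω) w) ∂P =
      ∫ ω, F ω * (G ω * W v ω) * W w ω ∂P - ∫ ω, F ω * W v ω * inner ℝ (E ω) w ∂P -
      (∫ ω, G ω * inner ℝ (D ω) v * W w ω ∂P - ∫ ω, inner ℝ (D ω) v * inner ℝ (E ω) w ∂P) := by
    rw [← integral_sub i1 i2, ← integral_sub (i3 v w) (i4 v w),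
      ← integral_sub ?_ ?_]
    rotate_left
    · exact i1.sub i2
    · exact (i3 v w).sub (i4 v w)
    refine integral_congr_ae (Eventually.of_forall fun ω => ?_)
    simp only
    ring
  rw [e4, e1, e2 v w, e2 w v, e3]
  ring

/-- The pairs `((F v, D F ⊗ v), F W(v) - ⟨D F, v⟩)` with `F` smooth cylindrical. -/
def skorohodGen (W : K → Lp ℝ 2 P) :
    Set (WithLp 2 (Lp K 2 P × Lp (HilbertTensor K K) 2 P) × Lp ℝ 2 P) :=
  {y | ∃ (F : Ω → ℝ) (D : Ω → K) (v : K), IsSmoothCyl W F D ∧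
    (y.1.fst =ᵐ[P] fun ω => F ω • v) ∧
    (y.1.snd =ᵐ[P] fun ω => ((D ω ⊗ₜ[ℝ] v : K ⊗[ℝ] K) : HilbertTensor K K)) ∧
    y.2 =ᵐ[P] fun ω => F ω * W v ω - inner ℝ (D ω) v}

/-- The graph of the Skorohod integral on `𝔻^{1,2}_W(K)`. -/
noncomputable def skorohodGraph (W : K → Lp ℝ 2 P) :
    Submodule ℝ (WithLp 2 (Lp K 2 P × Lp (HilbertTensor K K) 2 P) × Lp ℝ 2 P) :=
  (Submodule.span ℝ (skorohodGen W)).topologicalClosure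

theorem clm_eq_zero_of_closure_span {E : Type*} [NormedAddCommGroup E] [NormedSpace ℝ E]
    (l : E →L[ℝ] ℝ) {S : Set E} (h : ∀ y ∈ S, l y = 0) {y : E}
    (hy : y ∈ (Submodule.span ℝ S).topologicalClosure) : l y = 0 :=
  (Submodule.topologicalClosure_minimal _ (t := LinearMap.ker l.toLinearMap)
    (Submodule.span_le.2 h) l.isClosed_ker) hy

/-- The energy identity and the duality relation both say that a continuous bilinear form vanishes,
so this reduces each of them to generators. -/
theorem bilin_eq_zero_of_closure_span {E F : Type*} [NormedAddCommGroup E] [NormedSpace ℝ E]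
    [NormedAddCommGroup F] [NormedSpace ℝ F] (b : E →L[ℝ] F →L[ℝ] ℝ) {S : Set E} {T : Set F}
    (h : ∀ y ∈ S, ∀ z ∈ T, b y z = 0) {y : E} {z : F}
    (hy : y ∈ (Submodule.span ℝ S).topologicalClosure)
    (hz : z ∈ (Submodule.span ℝ T).topologicalClosure) : b y z = 0 :=
  clm_eq_zero_of_closure_span (b.flip z)
    (fun y hy => clm_eq_zero_of_closure_span (b y) (h y hy) hz) hy

/-- The exchange of the factors of a Hilbert space tensor square. -/
noncomputable def tensorSwap (K : Type*) [NormedAddCommGroup K] [InnerProductSpace ℝ K] :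
    HilbertTensor K K →L[ℝ] HilbertTensor K K :=
  (TensorProduct.commIsometry ℝ K K).toLinearIsometry.toContinuousLinearMap.completion

theorem norm_tensorSwap_le : ‖tensorSwap K‖ ≤ 1 := by
  refine ContinuousLinearMap.opNorm_le_bound _ zero_le_one fun x => ?_
  induction x using Completion.induction_on with
  | hp => exact isClosed_le (by fun_prop) (by fun_prop)
  | ih x =>
    rw [tensorSwap, ContinuousLinearMap.completion_apply_coe, Completion.norm_coe,
      Completion.norm_coe, one_mul]
    exact ((TensorProduct.commIsometry ℝ K K).norm_map x).le

@[simp] theorem tensorSwap_tmul (x y : K) :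
    tensorSwap K ((x ⊗ₜ[ℝ] y : K ⊗[ℝ] K) : HilbertTensor K K) =
      ((y ⊗ₜ[ℝ] x : K ⊗[ℝ] K) : HilbertTensor K K) := by
  rw [tensorSwap, ContinuousLinearMap.completion_apply_coe]
  rfl

/-- The bilinear form whose vanishing on the graph is the energy identity. -/
noncomputable def energyForm (P : Measure Ω) (K : Type*) [NormedAddCommGroup K]
    [InnerProductSpace ℝ K] :
    (WithLp 2 (Lp K 2 P × Lp (HilbertTensor K K) 2 P) × Lp ℝ 2 P) →L[ℝ]
      (WithLp 2 (Lp K 2 P × Lp (HilbertTensor K K) 2 P) × Lp ℝ 2 P) →L[ℝ] ℝ :=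
  let X := ContinuousLinearMap.snd ℝ (WithLp 2 (Lp K 2 P × Lp (HilbertTensor K K) 2 P)) (Lp ℝ 2 P)
  let Y := ContinuousLinearMap.fst ℝ (WithLp 2 (Lp K 2 P × Lp (HilbertTensor K K) 2 P)) (Lp ℝ 2 P)
  let A := (WithLp.fstL 2 ℝ (Lp K 2 P) (Lp (HilbertTensor K K) 2 P)).comp Y
  let B := (WithLp.sndL 2 ℝ (Lp K 2 P) (Lp (HilbertTensor K K) 2 P)).comp Y
  (innerSL ℝ).bilinearComp X X - (innerSL ℝ).bilinearComp A A -
    (innerSL ℝ).bilinearComp B (((tensorSwap K).compLpL 2 P).comp B)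

theorem energyForm_apply (y z : WithLp 2 (Lp K 2 P × Lp (HilbertTensor K K) 2 P) × Lp ℝ 2 P) :
    energyForm P K y z = inner ℝ y.2 z.2 - inner ℝ y.1.fst z.1.fst -
      inner ℝ y.1.snd ((tensorSwap K).compLpL 2 P z.1.snd) := rfl

variable [IsProbabilityMeasure P]

/-- On generators ⟨DF ⊗ v, w ⊗ DG⟩ = ⟨DF, w⟩⟨DG, v⟩, and the form is the defect in the energy
identity for the integrals of F v and G w. -/
theorem energyForm_eq_zero (hW : IsIsonormal W)
    {y z : WithLp 2 (Lp K 2 P × Lp (HilbertTensor K K) 2 P) × Lp ℝ 2 P}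
    (hy : y ∈ skorohodGraph W) (hz : z ∈ skorohodGraph W) : energyForm P K y z = 0 := by
  refine bilin_eq_zero_of_closure_span (energyForm P K) ?_ hy hz
  rintro y ⟨F, D, v, hF, hy1, hy2, hy3⟩ z ⟨G, E, w, hG, hz1, hz2, hz3⟩
  rw [energyForm_apply, sub_sub, sub_eq_zero, L2.inner_def, L2.inner_def, L2.inner_def]
  have e1 : ∫ ω, inner ℝ (y.2 ω) (z.2 ω) ∂P =
      ∫ ω, (F ω * W v ω - inner ℝ (D ω) v) * (G ω * W w ω - inner ℝ (E ω) w) ∂P :=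
    integral_congr_ae (by
      filter_upwards [hy3, hz3] with ω h1 h2
      rw [h1, h2]; simp [mul_comm])
  have e2 : ∫ ω, inner ℝ (y.1.fst ω) (z.1.fst ω) ∂P = ∫ ω, F ω * G ω * inner ℝ v w ∂P :=
    integral_congr_ae (by
      filter_upwards [hy1, hz1] with ω h1 h2
      rw [h1, h2, real_inner_smul_left, real_inner_smul_right, mul_assoc])
  have e3 : ∫ ω, inner ℝ (y.1.snd ω) ((tensorSwap K).compLpL 2 P z.1.snd ω) ∂P =
      ∫ ω, inner ℝ (D ω) w * inner ℝ (E ω) v ∂P :=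
    integral_congr_ae (by
      filter_upwards [hy2, hz2, (tensorSwap K).coeFn_compLpL (p := 2) (μ := P) z.1.snd] with ω h1 h2 h3
      rw [h3, h1, h2, tensorSwap_tmul, Completion.inner_coe, TensorProduct.inner_tmul,
        real_inner_comm v (E ω)])
  rw [e1, e2, e3]
  exact hF.integral_divergence_mul_divergence hW hG v w

/-- The energy identity on the diagonal, with Cauchy–Schwarz and the contractivity of the swap for
the derivative term. In particular the first component determines the second. -/
theorem norm_snd_le_of_mem_skorohodGraph (hW : IsIsonormal W)
    {y : WithLp 2 (Lp K 2 P × Lp (HilbertTensor K K) 2 P) × Lp ℝ 2 P}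
    (hy : y ∈ skorohodGraph W) : ‖y.2‖ ≤ ‖y.1‖ := by
  have h := energyForm_eq_zero hW hy hy
  rw [energyForm_apply, sub_sub, sub_eq_zero, real_inner_self_eq_norm_sq,
    real_inner_self_eq_norm_sq] at h
  refine le_of_sq_le_sq ?_ (norm_nonneg _)
  rw [h, WithLp.prod_norm_sq_eq_of_L2]
  have h1 := real_inner_le_norm y.1.snd ((tensorSwap K).compLpL 2 P y.1.snd)
  have h2 : ‖(tensorSwap K).compLpL 2 P y.1.snd‖ ≤ ‖y.1.snd‖ := by
    refine ((tensorSwap K).norm_compLp_le y.1.snd).trans ?_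
    exact mul_le_of_le_one_left (norm_nonneg _) norm_tensorSwap_le
  nlinarith [norm_nonneg y.1.snd]

/-- By the norm bound the first projection of the graph is isometric. The graph is complete, so the
range is closed, and it contains the generators of 𝔻^{1,2}_W(K). -/
theorem exists_mem_skorohodGraph [CompleteSpace K] (hW : IsIsonormal W)
    {x : WithLp 2 (Lp K 2 P × Lp (HilbertTensor K K) 2 P)} (hx : x ∈ sobolevV K W) :
    ∃ X, (x, X) ∈ skorohodGraph W := by
  set R := skorohodGraph W with hR
  let f : R →ₗᵢ[ℝ] WithLp 2 (Lp K 2 P × Lp (HilbertTensor K K) 2 P) :=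
    { toLinearMap := (LinearMap.fst ℝ _ _).comp R.subtype
      norm_map' := fun y => by
        change ‖y.1.1‖ = ‖y.1‖
        -- The product carries the maximum norm, and the bound says that the first component attains
        -- it.
        rw [Prod.norm_def, max_eq_left (norm_snd_le_of_mem_skorohodGraph hW y.2)] }
  have hcl : IsClosed (X := WithLp 2 (Lp K 2 P × Lp (HilbertTensor K K) 2 P))
      (LinearMap.range f.toLinearMap) := by
    have : CompleteSpace R := (Submodule.isClosed_topologicalClosure _).completeSpace_coe
    exact f.isometry.isClosedEmbedding.isClosed_range
  have hle : sobolevV K W ≤ LinearMap.range f.toLinearMap := by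
    refine Submodule.topologicalClosure_minimal _ (Submodule.span_le.2 ?_) hcl
    rintro x ⟨p, hp, v, h1, h2⟩
    obtain ⟨F, D, hF, hp1, hp2⟩ := mem_smoothPairs_iff.1 hp
    have hX : MemLp (fun ω => F ω * W v ω - inner ℝ (D ω) v) 2 P :=
      (hF.memLp_mul hW v).sub (hF.memLp_inner hW v)
    refine ⟨⟨(x, hX.toLp), Submodule.le_topologicalClosure _ (Submodule.subset_span
      ⟨F, D, v, hF, ?_, ?_, hX.coeFn_toLp⟩)⟩, rfl⟩
    · filter_upwards [h1, hp1] with ω h h'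
      rw [h, h']
    · filter_upwards [h2, hp2] with ω h h'
      rw [h, h']
  obtain ⟨y, hy⟩ := hle hx
  exact ⟨y.1.2, by rw [← hy]; exact y.2⟩

theorem IsSmoothCyl.exists_mem_sobolev (hW : IsIsonormal W) (hF : IsSmoothCyl W F D) :
    ∃ x ∈ sobolev W, x.fst =ᵐ[P] F ∧ x.snd =ᵐ[P] D := by
  have h1 := hF.isBddCyl.isCyl.memLp hW
  have h2 := hF.isBddCyl.memLp_grad
  exact ⟨WithLp.toLp 2 (h1.toLp, h2.toLp), Submodule.le_topologicalClosure _ (Submodule.subset_span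
    (mem_smoothPairs_iff.2 ⟨F, D, hF, h1.coeFn_toLp, h2.coeFn_toLp⟩)), h1.coeFn_toLp, h2.coeFn_toLp⟩

/-- The variable ⟨DF, v⟩ is again smooth cylindrical, but F W(v) may be unbounded; it is
approximated by F c⁻¹ sin(c W(v)) with c → 0. The closure is tested as a double orthogonal
complement, so convergence of the pairings with each Z suffices. -/
theorem mem_closure_of_ae_eq_divergence (hW : IsIsonormal W) (hF : IsSmoothCyl W F D) (v : K)
    {X : Lp ℝ 2 P} (hX : X =ᵐ[P] fun ω => F ω * W v ω - inner ℝ (D ω) v) :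
    X ∈ ((sobolev W).map (WithLp.fstₗ 2 ℝ (Lp ℝ 2 P) (Lp K 2 P))).topologicalClosure := by
  set M := (sobolev W).map (WithLp.fstₗ 2 ℝ (Lp ℝ 2 P) (Lp K 2 P)) with hM
  rw [← Submodule.orthogonal_orthogonal_eq_closure, Submodule.mem_orthogonal']
  intro Z hZ
  have key : ∀ {G : Ω → ℝ} {E : Ω → K}, IsSmoothCyl W G E → ∫ ω, G ω * Z ω ∂P = 0 := by
    intro G E hG
    obtain ⟨x, hx, hx1, -⟩ := hG.exists_mem_sobolev hW
    have h1 := (Submodule.mem_orthogonal _ _).1 hZ x.fst ⟨x, hx, rfl⟩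
    rw [L2.inner_def] at h1
    rw [← h1]
    refine integral_congr_ae ?_
    filter_upwards [hx1] with ω h
    rw [h]; simp [mul_comm]
  have i1 : Integrable (fun ω => F ω * W v ω * Z ω) P := (hF.memLp_mul hW v).integrable_mul (Lp.memLp Z)
  have i2 : Integrable (fun ω => inner ℝ (D ω) v * Z ω) P :=
    (hF.memLp_inner hW v).integrable_mul (Lp.memLp Z)
  obtain ⟨D2, hD2, -⟩ := hF.exists_second
  have z2 : ∫ ω, inner ℝ (D ω) v * Z ω ∂P = 0 := key (hD2 v)
  have z1 : ∫ ω, F ω * W v ω * Z ω ∂P = 0 := by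
    have hz : ∀ n : ℕ, ∫ ω, F ω * (((n : ℝ) + 1)⁻¹⁻¹ * Real.sin (((n : ℝ) + 1)⁻¹ * W v ω)) * Z ω ∂P
        = 0 := fun n => by
      obtain ⟨E, hE⟩ := isSmoothCyl_sin W v ((n : ℝ) + 1)⁻¹
      exact key (hF.mul hE)
    have hlim : Tendsto (fun n : ℕ =>
        ∫ ω, F ω * (((n : ℝ) + 1)⁻¹⁻¹ * Real.sin (((n : ℝ) + 1)⁻¹ * W v ω)) * Z ω ∂P) atTop
        (𝓝 (∫ ω, F ω * W v ω * Z ω ∂P)) := by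
      refine tendsto_integral_of_dominated_convergence (fun ω => ‖F ω * W v ω * Z ω‖)
        (fun n => ?_) i1.norm (fun n => Eventually.of_forall fun ω => ?_)
        (Eventually.of_forall fun ω => ?_)
      · obtain ⟨E, hE⟩ := isSmoothCyl_sin W v ((n : ℝ) + 1)⁻¹
        exact ((hF.mul hE).isBddCyl.isCyl.memLp hW).aestronglyMeasurable.mul
          (Lp.aestronglyMeasurable Z)
      · have hpos : (0 : ℝ) < ((n : ℝ) + 1)⁻¹ := by positivity
        simp only [norm_mul, Real.norm_eq_abs]
        gcongr
        rw [abs_of_pos (inv_pos.2 hpos), inv_mul_le_iff₀ hpos]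
        refine Real.abs_sin_le_abs.trans ?_
        rw [abs_mul, abs_of_pos hpos]
      · refine (Tendsto.const_mul _ ?_).mul_const _
        -- The pointwise limit is the derivative of t ↦ sin(t W(v)) at 0, taken along t = 1/(n + 1).
        have h1 : HasDerivAt (fun t : ℝ => Real.sin (t * W v ω)) (W v ω) 0 := by
          have := ((hasDerivAt_id (0 : ℝ)).mul_const (W v ω)).sin
          simpa using this
        have h2 := h1.tendsto_slope_zero
        have h3 : Tendsto (fun n : ℕ => ((n : ℝ) + 1)⁻¹) atTop (𝓝[≠] 0) := by
          refine tendsto_nhdsWithin_iff.2 ⟨?_, Eventually.of_forall fun n => ?_⟩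
          · simpa using tendsto_one_div_add_atTop_nhds_zero_nat (𝕜 := ℝ)
          · have : (0 : ℝ) < ((n : ℝ) + 1)⁻¹ := by positivity
            exact this.ne'
        simpa [Function.comp_def] using h2.comp h3
    refine tendsto_nhds_unique hlim ?_
    simp only [hz]
    exact tendsto_const_nhds
  rw [L2.inner_def]
  calc _ = ∫ ω, (F ω * W v ω * Z ω - inner ℝ (D ω) v * Z ω) ∂P := by
        refine integral_congr_ae ?_
        filter_upwards [hX] with ω h
        rw [h]; simp; ring
    _ = 0 := by rw [integral_sub i1 i2, z1, z2, sub_zero]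

/-- The bilinear form whose vanishing is the duality relation. -/
noncomputable def dualityForm (P : Measure Ω) (K : Type*) [NormedAddCommGroup K]
    [InnerProductSpace ℝ K] :
    WithLp 2 (Lp ℝ 2 P × Lp K 2 P) →L[ℝ]
      (WithLp 2 (Lp K 2 P × Lp (HilbertTensor K K) 2 P) × Lp ℝ 2 P) →L[ℝ] ℝ :=
  (innerSL ℝ).bilinearComp (WithLp.fstL 2 ℝ (Lp ℝ 2 P) (Lp K 2 P))
      (ContinuousLinearMap.snd ℝ (WithLp 2 (Lp K 2 P × Lp (HilbertTensor K K) 2 P)) (Lp ℝ 2 P)) -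
    (innerSL ℝ).bilinearComp (WithLp.sndL 2 ℝ (Lp ℝ 2 P) (Lp K 2 P))
      ((WithLp.fstL 2 ℝ (Lp K 2 P) (Lp (HilbertTensor K K) 2 P)).comp
        (ContinuousLinearMap.fst ℝ (WithLp 2 (Lp K 2 P × Lp (HilbertTensor K K) 2 P)) (Lp ℝ 2 P)))

omit [IsProbabilityMeasure P] in
theorem dualityForm_apply (x : WithLp 2 (Lp ℝ 2 P × Lp K 2 P))
    (y : WithLp 2 (Lp K 2 P × Lp (HilbertTensor K K) 2 P) × Lp ℝ 2 P) :
    dualityForm P K x y = inner ℝ x.fst y.2 - inner ℝ x.snd y.1.fst := rfl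

/-- Both requirements are closed conditions, membership in a closed subspace and the vanishing of
`dualityForm`, so generators suffice. -/
theorem isSkorohod_of_mem_skorohodGraph (hW : IsIsonormal W)
    {y : WithLp 2 (Lp K 2 P × Lp (HilbertTensor K K) 2 P) × Lp ℝ 2 P}
    (hy : y ∈ skorohodGraph W) : IsSkorohod W y.1.fst y.2 := by
  constructor
  · set M := (sobolev W).map (WithLp.fstₗ 2 ℝ (Lp ℝ 2 P) (Lp K 2 P)) with hM
    refine (Submodule.topologicalClosure_minimal _ (t := M.topologicalClosure.comap
      (LinearMap.snd ℝ _ _)) (Submodule.span_le.2 ?_) ?_) hy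
    · rintro y ⟨F, D, v, hF, -, -, h⟩
      exact mem_closure_of_ae_eq_divergence hW hF v h
    · exact M.isClosed_topologicalClosure.preimage continuous_snd
  · intro x hx
    have h := bilin_eq_zero_of_closure_span (dualityForm P K) (fun x hx y hy => ?_) hx hy
    · rw [dualityForm_apply, sub_eq_zero, L2.inner_def, L2.inner_def] at h
      rw [← h]
      exact integral_congr_ae (Eventually.of_forall fun ω => by simp [mul_comm])
    · obtain ⟨F, D, hF, h1, h2⟩ := mem_smoothPairs_iff.1 hx
      obtain ⟨G, E, v, hG, h3, h4, h5⟩ := hy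
      rw [dualityForm_apply, sub_eq_zero, L2.inner_def, L2.inner_def]
      refine (integral_congr_ae ?_).trans
        ((hF.integral_mul_divergence hW hG v).trans (integral_congr_ae ?_))
      · filter_upwards [h1, h5] with ω h h'
        change x.fst ω = _ at h
        rw [h, h']
        simp [mul_comm]
      · filter_upwards [h2, h3] with ω h h'
        change x.snd ω = _ at h
        rw [h, h', real_inner_smul_right]

end


/-! ### The Gaussian processes are isonormal -/

section

variable {Ω : Type*} [MeasurableSpace Ω] {P : Measure Ω}

/-- The elements of `L²(Ω)` with the characteristic function of a centred Gaussian variable at `1`. -/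
def centredGaussian (P : Measure Ω) : Set (Lp ℝ 2 P) :=
  {X | ∫ ω, Complex.exp (Complex.I * (X ω : ℂ)) ∂P = Complex.exp (-(‖X‖ : ℂ) ^ 2 / 2)}

theorem norm_cexp_sub_cexp_le (x y : ℝ) :
    ‖Complex.exp (Complex.I * x) - Complex.exp (Complex.I * y)‖ ≤ |x - y| := by
  have h : Complex.exp (Complex.I * x) - Complex.exp (Complex.I * y) =
      Complex.exp (y * Complex.I) * (Complex.exp (Complex.I * (x - y : ℝ)) - 1) := by
    rw [mul_sub, ← Complex.exp_add, mul_one]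
    push_cast
    ring_nf
  rw [h, norm_mul, Complex.norm_exp_ofReal_mul_I, one_mul]
  exact Real.norm_exp_I_mul_ofReal_sub_one_le

theorem integrable_cexp [IsFiniteMeasure P] (X : Lp ℝ 2 P) :
    Integrable (fun ω => Complex.exp (Complex.I * (X ω : ℂ))) P := by
  refine Integrable.of_bound (C := 1) ?_ (Eventually.of_forall fun ω => ?_)
  · have h : Continuous fun x : ℝ => Complex.exp (Complex.I * (x : ℂ)) := by fun_prop
    exact h.comp_aestronglyMeasurable (Lp.aestronglyMeasurable X)
  · rw [mul_comm, Complex.norm_exp_ofReal_mul_I]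

/-- X ↦ E exp(iX) is 1-Lipschitz on L², by |e^{ix} − e^{iy}| ≤ |x − y| and the comparison of the L¹
and L² norms under a probability measure. The other side depends continuously on ‖X‖. -/
theorem isClosed_centredGaussian [IsProbabilityMeasure P] : IsClosed (centredGaussian P) := by
  refine isClosed_eq ?_ (by fun_prop)
  refine LipschitzWith.continuous (K := 1) (LipschitzWith.of_dist_le_mul fun X Y => ?_)
  rw [NNReal.coe_one, one_mul, dist_eq_norm, dist_eq_norm,
    ← integral_sub (integrable_cexp X) (integrable_cexp Y)]
  refine (norm_integral_le_integral_norm _).trans ?_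
  have hm : MemLp (⇑(X - Y)) 2 P := Lp.memLp _
  have h1 : ∫ ω, ‖Complex.exp (Complex.I * (X ω : ℂ)) - Complex.exp (Complex.I * (Y ω : ℂ))‖ ∂P ≤
      ∫ ω, ‖(X - Y) ω‖ ∂P := by
    refine integral_mono_ae ((integrable_cexp X).sub (integrable_cexp Y)).norm
      (hm.integrable one_le_two).norm ?_
    filter_upwards [Lp.coeFn_sub X Y] with ω h
    rw [h]
    exact norm_cexp_sub_cexp_le _ _
  refine h1.trans ?_
  rw [integral_norm_eq_lintegral_enorm hm.1, Lp.norm_def, ← eLpNorm_one_eq_lintegral_enorm]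
  exact ENNReal.toReal_mono (Lp.eLpNorm_ne_top _)
    (eLpNorm_le_eLpNorm_of_exponent_le one_le_two hm.1)

theorem mem_centredGaussian {X : Lp ℝ 2 P} (hX : HasGaussianLaw X P) (h0 : ∫ ω, X ω ∂P = 0) :
    X ∈ centredGaussian P := by
  have hm : AEMeasurable X P := hX.aemeasurable
  have h1 := hX.map_eq_gaussianReal
  have h2 : Var[X; P] = ‖X‖ ^ 2 := by
    rw [variance_of_integral_eq_zero hm h0, ← real_inner_self_eq_norm_sq, L2.inner_def]
    exact integral_congr_ae (Eventually.of_forall fun ω => by simp [sq])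
  have h3 := charFun_gaussianReal (μ := 0) (v := (‖X‖ ^ 2).toNNReal) 1
  rw [h0, h2] at h1
  rw [← h1, charFun_apply, integral_map hm (by fun_prop)] at h3
  simp only [Complex.ofReal_zero, mul_zero, zero_mul, zero_sub, Complex.ofReal_one,
    one_pow, mul_one, Real.coe_toNNReal _ (sq_nonneg ‖X‖)] at h3
  rw [centredGaussian, Set.mem_ofPred_eq, neg_div]
  rw [Complex.ofReal_pow] at h3
  rw [← h3]
  refine integral_congr_ae (Eventually.of_forall fun ω => ?_)
  simp [mul_comm]

variable {K : Type*} [NormedAddCommGroup K] [InnerProductSpace ℝ K]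

/-- One value of the characteristic function is enough because the range of L is stable under
scaling: the value at t for L φ is the value at 1 for L(tφ). -/
theorem isIsonormal_of_isometry [IsProbabilityMeasure P] (L : K →ₗᵢ[ℝ] Lp ℝ 2 P)
    (hL : ∀ φ, L φ ∈ centredGaussian P) : IsIsonormal L where
  map_add := L.map_add
  map_smul := L.map_smul
  law φ := by
    have hm : AEMeasurable (L φ) P := IsIsonormal.aemeasurable L φ
    have := Measure.isProbabilityMeasure_map hm
    refine Measure.ext_of_charFun (funext fun t => ?_)
    rw [charFun_gaussianReal, charFun_apply, integral_map hm (by fun_prop)]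
    have h := hL (t • φ)
    rw [centredGaussian, Set.mem_ofPred_eq, L.norm_map, norm_smul] at h
    have e : ∫ ω, Complex.exp (((inner ℝ (L φ ω) t : ℝ) : ℂ) * Complex.I) ∂P =
        ∫ ω, Complex.exp (Complex.I * (L (t • φ) ω : ℂ)) ∂P := by
      refine integral_congr_ae ?_
      rw [L.map_smul]
      filter_upwards [Lp.coeFn_smul t (L φ)] with ω h
      rw [h]
      simp [mul_comm]
    rw [e, h]
    congr 1
    have h2 : ((‖t‖ : ℂ)) ^ 2 = (t : ℂ) ^ 2 := by
      rw [← Complex.ofReal_pow, ← Complex.ofReal_pow, Real.norm_eq_abs, sq_abs]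
    push_cast
    rw [mul_pow, h2]
    simp
    ring

/-! ### Wiener integrals with respect to independent fractional Brownian motions. -/

variable {H : HurstIndex} {T : ℝ}

theorem linearCombination_ae {β : Set.Icc (0 : ℝ) T → Ω → ℝ} (hβ : IsFBM H T β P)
    (c : Set.Icc (0 : ℝ) T →₀ ℝ) :
    Finsupp.linearCombination ℝ (fun t => (hβ.memLp t).toLp) c =ᵐ[P]
      fun ω => ∑ t ∈ c.support, c t * β t ω := by
  rw [Finsupp.linearCombination_apply, Finsupp.sum]
  have h : ∀ᵐ ω ∂P, ∀ t ∈ c.support, (c t • (hβ.memLp t).toLp : Lp ℝ 2 P) ω = c t * β t ω := by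
    refine (Filter.eventually_all_finset _).2 fun t _ => ?_
    filter_upwards [Lp.coeFn_smul (c t) (hβ.memLp t).toLp, (hβ.memLp t).coeFn_toLp] with ω h1 h2
    rw [h1, Pi.smul_apply, h2, smul_eq_mul]
  filter_upwards [h, Lp.coeFn_finsetSum c.support fun t => c t • (hβ.memLp t).toLp] with ω h1 h2
  rw [h2, Finset.sum_apply]
  exact Finset.sum_congr rfl h1

theorem IsFBM.hasGaussianLaw_sum {β : Set.Icc (0 : ℝ) T → Ω → ℝ} (hβ : IsFBM H T β P)
    (c : Set.Icc (0 : ℝ) T →₀ ℝ) :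
    HasGaussianLaw (fun ω => ∑ t ∈ c.support, c t * β t ω) P := by
  have h := (hβ.gaussian.hasGaussianLaw c.support).map_fun
    (∑ t : c.support, c t • ContinuousLinearMap.proj (R := ℝ) (φ := fun _ : c.support => ℝ) t)
  have e : (fun ω => ∑ t ∈ c.support, c t * β t ω) = fun ω =>
      (∑ t : c.support, c t • ContinuousLinearMap.proj (R := ℝ) (φ := fun _ : c.support => ℝ) t)
        (c.support.restrict fun t => β t ω) := by
    ext ω
    rw [← Finset.sum_coe_sort]
    simp
  rw [e]
  exact h

theorem IsFBM.integral_sum {β : Set.Icc (0 : ℝ) T → Ω → ℝ} (hβ : IsFBM H T β P)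
    (c : Set.Icc (0 : ℝ) T →₀ ℝ) : ∫ ω, ∑ t ∈ c.support, c t * β t ω ∂P = 0 := by
  rw [integral_finsetSum]
  · refine Finset.sum_eq_zero fun t _ => ?_
    rw [integral_const_mul, hβ.mean, mul_zero]
  · intro t _
    exact (hβ.gaussian.hasGaussianLaw_eval t).integrable.const_mul _

theorem wiener_linearCombination {β : Set.Icc (0 : ℝ) T → Ω → ℝ} (hβ : IsFBM H T β P)
    (c : Set.Icc (0 : ℝ) T →₀ ℝ) : wiener hβ (Finsupp.linearCombination ℝ (indic H T) c) =
      Finsupp.linearCombination ℝ (fun t => (hβ.memLp t).toLp) c :=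
  LinearMap.extendOfNorm_eq (span_indic H T)
    ⟨1, fun c => by rw [one_mul]; exact (norm_linearCombination_eq hβ c).le⟩ c

/-- The Wiener integral as a linear isometry. -/
noncomputable def wienerIsometry {β : Set.Icc (0 : ℝ) T → Ω → ℝ} (hβ : IsFBM H T β P) :
    FracSpace H T ℝ →ₗᵢ[ℝ] Lp ℝ 2 P where
  toLinearMap := (wiener hβ).toLinearMap
  norm_map' φ := by
    change ‖wiener hβ φ‖ = ‖φ‖
    refine (span_indic H T).induction_on φ (isClosed_eq (by fun_prop) (by fun_prop)) fun c => ?_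
    rw [wiener_linearCombination, norm_linearCombination_eq hβ]

@[simp] theorem wienerIsometry_apply {β : Set.Icc (0 : ℝ) T → Ω → ℝ} (hβ : IsFBM H T β P)
    (φ : FracSpace H T ℝ) : wienerIsometry hβ φ = wiener hβ φ := rfl

variable {β : ℕ → Set.Icc (0 : ℝ) T → Ω → ℝ}

/-- For finite combinations of the values of βʲ and βᵏ the inner product is the expectation of a
product of independent centred variables; density does the rest. -/
theorem orthogonalFamily_wiener (hβ : ∀ k, IsFBM H T (β k) P)
    (hindep : iIndepFun (fun k ω t => β k t ω) P) :
    OrthogonalFamily ℝ (fun _ : ℕ => FracSpace H T ℝ) fun k => wienerIsometry (hβ k) := by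
  intro j k hjk φ ψ
  simp only [wienerIsometry_apply]
  refine (span_indic H T).induction_on₂ (p := fun φ ψ =>
    inner ℝ (wiener (hβ j) φ) (wiener (hβ k) ψ) = (0 : ℝ))
    (isClosed_eq (by fun_prop) (by fun_prop)) (fun c d => ?_) φ ψ
  rw [wiener_linearCombination, wiener_linearCombination, L2.inner_def]
  have hi : IndepFun (fun ω => ∑ t ∈ c.support, c t * β j t ω)
      (fun ω => ∑ t ∈ d.support, d t * β k t ω) P :=
    (hindep.indepFun hjk).comp (φ := fun x : Set.Icc (0 : ℝ) T → ℝ => ∑ t ∈ c.support, c t * x t)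
      (ψ := fun x : Set.Icc (0 : ℝ) T → ℝ => ∑ t ∈ d.support, d t * x t)
      (by fun_prop) (by fun_prop)
  have h := hi.integral_fun_mul_eq_mul_integral
    ((hβ j).hasGaussianLaw_sum c).aemeasurable.aestronglyMeasurable
    ((hβ k).hasGaussianLaw_sum d).aemeasurable.aestronglyMeasurable
  rw [(hβ j).integral_sum, zero_mul] at h
  refine Eq.trans (integral_congr_ae ?_) h
  filter_upwards [linearCombination_ae (hβ j) c, linearCombination_ae (hβ k) d] with ω h1 h2
  rw [h1, h2]
  simp [mul_comm]

/-- For step functions this is a sum of independent centred Gaussian variables. Density in the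
finite product of copies of 𝓗 and closedness of `centredGaussian P` give the general case. -/
theorem sum_wiener_mem_centredGaussian [IsProbabilityMeasure P] (hβ : ∀ k, IsFBM H T (β k) P)
    (hindep : iIndepFun (fun k ω t => β k t ω) P) (s : Finset ℕ) (φ : s → FracSpace H T ℝ) :
    ∑ k : s, wiener (hβ k) (φ k) ∈ centredGaussian P := by
  have hd : DenseRange (Pi.map fun _ : s => ⇑(Finsupp.linearCombination ℝ (indic H T))) :=
    DenseRange.piMap fun _ => span_indic H T
  refine hd.induction_on (p := fun φ => ∑ k : s, wiener (hβ k) (φ k) ∈ centredGaussian P) φ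
    (isClosed_centredGaussian.preimage (by fun_prop)) fun c => ?_
  have hae : (∑ k : s, wiener (hβ k) (Pi.map (fun _ : s =>
      ⇑(Finsupp.linearCombination ℝ (indic H T))) c k) : Lp ℝ 2 P) =ᵐ[P]
      fun ω => ∑ k : s, ∑ t ∈ (c k).support, c k t * β k t ω := by
    have h : ∀ᵐ ω ∂P, ∀ k : s, (wiener (hβ k) (Finsupp.linearCombination ℝ (indic H T) (c k))) ω =
        ∑ t ∈ (c k).support, c k t * β k t ω := ae_all_iff.2 fun k => by
      rw [wiener_linearCombination]
      exact linearCombination_ae (hβ k) (c k)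
    filter_upwards [h, Lp.coeFn_finsetSum Finset.univ fun k : s =>
      wiener (hβ k) (Finsupp.linearCombination ℝ (indic H T) (c k))] with ω h1 h2
    refine h2.trans ?_
    rw [Finset.sum_apply]
    exact Finset.sum_congr rfl fun k _ => h1 k
  have hi : iIndepFun (fun (k : s) ω => ∑ t ∈ (c k).support, c k t * β k t ω) P :=
    (hindep.precomp (g := fun k : s => (k : ℕ)) Subtype.val_injective).comp (β := fun _ => Set.Icc (0 : ℝ) T → ℝ)
      (fun (k : s) (x : Set.Icc (0 : ℝ) T → ℝ) => ∑ t ∈ (c k).support, c k t * x t)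
      fun k => by fun_prop
  have hg : ∀ k : s, HasGaussianLaw (fun ω => ∑ t ∈ (c k).support, c k t * β k t ω) P :=
    fun k => (hβ k).hasGaussianLaw_sum (c k)
  refine mem_centredGaussian ((iIndepFun.hasGaussianLaw_fun_sum hg hi).congr hae.symm) ?_
  rw [integral_congr_ae hae, integral_finsetSum]
  · exact Finset.sum_eq_zero fun k _ => (hβ k).integral_sum (c k)
  · exact fun k _ => ((hβ k).hasGaussianLaw_sum (c k)).integrable

theorem isIsonormal_wiener [IsProbabilityMeasure P] (hβ : ∀ k, IsFBM H T (β k) P)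
    (hindep : iIndepFun (fun k ω t => β k t ω) P) (k : ℕ) : IsIsonormal (wiener (hβ k)) :=
  isIsonormal_of_isometry (wienerIsometry (hβ k)) fun φ => by
    simpa using sum_wiener_mem_centredGaussian hβ hindep {k} fun _ => φ

/-! ### Decomposition of 𝓗_V along the orthonormal basis, and the process B. -/

variable {V : Type*} [NormedAddCommGroup V] [InnerProductSpace ℝ V] [CompleteSpace V]

theorem timesVec_coe (H : HurstIndex) (T : ℝ) (v : V) (φ : Elem H T ℝ) :
    timesVec H T v (φ : FracSpace H T ℝ) = (elemTimes H T v φ : FracSpace H T V) :=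
  ContinuousLinearMap.completion_apply_coe _ _

/-- For elementary functions ⟨v, w⟩ factors out of the double integral. The isometry and
orthogonality statements about multiplication by vectors all rest on this. -/
theorem inner_timesVec (H : HurstIndex) (T : ℝ) (v w : V) (φ ψ : FracSpace H T ℝ) :
    inner ℝ (timesVec H T v φ) (timesVec H T w ψ) = inner ℝ v w * (inner ℝ φ ψ : ℝ) := by
  induction φ, ψ using Completion.induction_on₂ with
  | hp => exact isClosed_eq (by fun_prop) (by fun_prop)
  | ih φ ψ =>
    rw [timesVec_coe, timesVec_coe, Completion.inner_coe, Completion.inner_coe, elem_inner_def,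
      elem_inner_def, ← integral_const_mul]
    refine integral_congr_ae (Eventually.of_forall fun p => ?_)
    change inner ℝ (φ.1 p.1 • v) (ψ.1 p.2 • w) * _ = _ * ((ψ.1 p.2 * φ.1 p.1) * _)
    rw [real_inner_smul_left, real_inner_smul_right]
    ring

/-- `φ ↦ φ v` as a linear isometry, for a unit vector `v`. -/
noncomputable def timesVecIsometry (H : HurstIndex) (T : ℝ) (v : V) (hv : ‖v‖ = 1) :
    FracSpace H T ℝ →ₗᵢ[ℝ] FracSpace H T V where
  toLinearMap := (timesVec H T v).toLinearMap
  norm_map' φ := by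
    change ‖timesVec H T v φ‖ = ‖φ‖
    rw [← sq_eq_sq₀ (norm_nonneg _) (norm_nonneg _), ← real_inner_self_eq_norm_sq,
      inner_timesVec, real_inner_self_eq_norm_sq, real_inner_self_eq_norm_sq, hv]
    simp

@[simp] theorem timesVecIsometry_apply (H : HurstIndex) (T : ℝ) (v : V) (hv : ‖v‖ = 1)
    (φ : FracSpace H T ℝ) : timesVecIsometry H T v hv φ = timesVec H T v φ := rfl

/-- `v ↦ φ v`, for an elementary function `φ`. -/
noncomputable def elemTimesVec (H : HurstIndex) (T : ℝ) (φ : Elem H T ℝ) : V →L[ℝ] FracSpace H T V :=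
  LinearMap.mkContinuous
    { toFun := fun v => timesVec H T v φ
      map_add' := fun v w => by
        simp only [timesVec_coe]
        rw [← Completion.coe_add]
        congr 1
        exact Subtype.ext (funext fun t => smul_add (φ.1 t) v w)
      map_smul' := fun c v => by
        simp only [timesVec_coe, RingHom.id_apply]
        rw [← Completion.coe_smul]
        congr 1
        exact Subtype.ext (funext fun t => smul_comm (φ.1 t) c v) }
    ‖(φ : FracSpace H T ℝ)‖ fun v => by
      refine le_of_sq_le_sq (le_of_eq ?_) (by positivity)
      change ‖timesVec H T v φ‖ ^ 2 = _
      rw [mul_pow, ← real_inner_self_eq_norm_sq, inner_timesVec, real_inner_self_eq_norm_sq,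
        real_inner_self_eq_norm_sq, mul_comm]

@[simp] theorem elemTimesVec_apply (H : HurstIndex) (T : ℝ) (φ : Elem H T ℝ) (v : V) :
    elemTimesVec H T φ v = timesVec H T v φ := rfl

omit [CompleteSpace V] in
theorem norm_hilbertBasis (e : HilbertBasis ℕ ℝ V) (k : ℕ) : ‖e k‖ = 1 := e.orthonormal.1 k

/-- Completeness: for elementary φ the map v ↦ φ v is continuous, so the closed span of the ranges
contains φ v for every v and not only for the eₖ. With φ an indicator of (a, b] these vectors span
the elementary functions. -/
theorem isHilbertSum_timesVec (e : HilbertBasis ℕ ℝ V) (H : HurstIndex) (T : ℝ) :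
    IsHilbertSum ℝ (fun _ : ℕ => FracSpace H T ℝ)
      fun k => timesVecIsometry H T (e k) (norm_hilbertBasis e k) := by
  refine IsHilbertSum.mk (fun j k hjk φ ψ => ?_) ?_
  · simp only [timesVecIsometry_apply, inner_timesVec, e.orthonormal.2 hjk, zero_mul]
  · set S := (⨆ k, LinearMap.range
      (timesVecIsometry H T (e k) (norm_hilbertBasis e k)).toLinearMap).topologicalClosure with hS
    have hcl : IsClosed (S : Set (FracSpace H T V)) := Submodule.isClosed_topologicalClosure _
    have h1 : ∀ (φ : Elem H T ℝ) (v : V), timesVec H T v φ ∈ S := by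
      intro φ v
      have hle : (Submodule.span ℝ (Set.range e)).topologicalClosure ≤
          S.comap (elemTimesVec H T φ).toLinearMap := by
        refine Submodule.topologicalClosure_minimal _ (Submodule.span_le.2 ?_)
          (hcl.preimage (elemTimesVec H T φ).continuous)
        rintro _ ⟨k, rfl⟩
        exact Submodule.le_topologicalClosure _ (Submodule.mem_iSup_of_mem k ⟨φ, rfl⟩)
      rw [e.dense_span] at hle
      exact hle (Submodule.mem_top (x := v))
    have h2 : ∀ (φ : ℝ → V) (hφ : φ ∈ elementary T V), (Elem.of H φ hφ : FracSpace H T V) ∈ S := by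
      intro φ hφ
      induction hφ using Submodule.span_induction with
      | mem x h =>
        obtain ⟨a, b, v, ha, hab, hb, rfl⟩ := h
        have h3 := h1 (Elem.of H ((Set.Ioc a b).indicator fun _ => (1 : ℝ))
          (Submodule.subset_span ⟨a, b, 1, ha, hab, hb, rfl⟩)) v
        rw [timesVec_coe] at h3
        convert h3 using 2
        refine Subtype.ext (funext fun t => ?_)
        change _ = (Set.Ioc a b).indicator (fun _ => (1 : ℝ)) t • v
        change (Set.Ioc a b).indicator (fun _ => v) t = _
        by_cases ht : t ∈ Set.Ioc a b <;> simp [ht]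
      | zero => exact S.zero_mem
      | add x y hx hy h1 h2 =>
        have := S.add_mem h1 h2
        rwa [← Completion.coe_add] at this
      | smul c x hx h1 =>
        have := S.smul_mem c h1
        rwa [← Completion.coe_smul] at this
    rintro φ -
    induction φ using Completion.induction_on with
    | hp => exact hcl
    | ih φ => exact h2 φ.1 φ.2

theorem coord_timesVec (e : HilbertBasis ℕ ℝ V) (H : HurstIndex) (T : ℝ) (j k : ℕ)
    (φ : FracSpace H T ℝ) : coord H T (e j) (timesVec H T (e k) φ) = if j = k then φ else 0 := by
  refine ext_inner_right ℝ fun ψ => ?_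
  rw [coord, ContinuousLinearMap.adjoint_inner_left, inner_timesVec,
    orthonormal_iff_ite.1 e.orthonormal]
  rcases eq_or_ne j k with rfl | h
  · simp
  · simp [h, h.symm]

/-- Apply the coordinate map to the orthogonal expansion of φ; one term survives. This ties the
adjoints used in `jointProcess` to the Hilbert sum decomposition. -/
theorem coord_eq (e : HilbertBasis ℕ ℝ V) (φ : FracSpace H T V) (k : ℕ) :
    coord H T (e k) φ = (isHilbertSum_timesVec e H T).linearIsometryEquiv φ k := by
  set w := (isHilbertSum_timesVec e H T).linearIsometryEquiv φ with hw
  have h1 := (isHilbertSum_timesVec e H T).hasSum_linearIsometryEquiv_symm w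
  rw [hw, LinearIsometryEquiv.symm_apply_apply, ← hw] at h1
  have h2 := h1.mapL (coord H T (e k))
  simp only [timesVecIsometry_apply, coord_timesVec] at h2
  have h3 := hasSum_single (f := fun j => if k = j then w j else 0) k fun j hj => if_neg hj.symm
  rw [if_pos rfl] at h3
  exact h2.unique h3

/-- The process `B` as a linear isometry. -/
noncomputable def jointIsometry (e : HilbertBasis ℕ ℝ V) (hβ : ∀ k, IsFBM H T (β k) P)
    (hindep : iIndepFun (fun k ω t => β k t ω) P) : FracSpace H T V →ₗᵢ[ℝ] Lp ℝ 2 P :=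
  (orthogonalFamily_wiener hβ hindep).linearIsometry.comp
    (isHilbertSum_timesVec e H T).linearIsometryEquiv.toLinearIsometry

theorem jointIsometry_apply (e : HilbertBasis ℕ ℝ V) (hβ : ∀ k, IsFBM H T (β k) P)
    (hindep : iIndepFun (fun k ω t => β k t ω) P) (φ : FracSpace H T V) :
    jointIsometry e hβ hindep φ = jointProcess e hβ φ := by
  change (orthogonalFamily_wiener hβ hindep).linearIsometry _ = _
  rw [OrthogonalFamily.linearIsometry_apply, jointProcess]
  simp only [coord_eq]
  rfl

/-- B is a composition of isometries, and each B(φ) is an L² limit of finite sums of independent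
Wiener integrals. -/
theorem isIsonormal_jointProcess [IsProbabilityMeasure P] (e : HilbertBasis ℕ ℝ V)
    (hβ : ∀ k, IsFBM H T (β k) P) (hindep : iIndepFun (fun k ω t => β k t ω) P) :
    IsIsonormal (jointProcess e hβ) := by
  have h0 : jointProcess e hβ = jointIsometry e hβ hindep :=
    funext fun φ => (jointIsometry_apply e hβ hindep φ).symm
  rw [h0]
  refine isIsonormal_of_isometry _ fun φ => ?_
  have h1 := (orthogonalFamily_wiener hβ hindep).hasSum_linearIsometry
    ((isHilbertSum_timesVec e H T).linearIsometryEquiv φ)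
  refine isClosed_centredGaussian.mem_of_tendsto h1 (Eventually.of_forall fun s => ?_)
  rw [← Finset.sum_coe_sort]
  exact sum_wiener_mem_centredGaussian hβ hindep s _

/-- Orthonormality leaves one term of the series. Through this identity functionals of βᵏ become
functionals of B. -/
theorem jointProcess_timesVec (e : HilbertBasis ℕ ℝ V) (hβ : ∀ k, IsFBM H T (β k) P) (k : ℕ)
    (φ : FracSpace H T ℝ) : jointProcess e hβ (timesVec H T (e k) φ) = wiener (hβ k) φ := by
  rw [jointProcess, tsum_eq_single k]
  · rw [coord_timesVec, if_pos rfl]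
  · intro j hj
    rw [coord_timesVec, if_neg hj, map_zero]

end


/-! ### Transport from the components to the joint process -/

section

variable {Ω : Type*} [MeasurableSpace Ω] {P : Measure Ω}

section

variable {K : Type*} [NormedAddCommGroup K] [InnerProductSpace ℝ K] {W : K → Lp ℝ 2 P}

/-- Generators project to generators. Thus transporting the graph also transports membership in
𝔻^{1,2}. -/
theorem fst_mem_sobolevV_of_mem_skorohodGraph [IsProbabilityMeasure P]
    (hW : IsIsonormal W) {y : WithLp 2 (Lp K 2 P × Lp (HilbertTensor K K) 2 P) × Lp ℝ 2 P}
    (hy : y ∈ skorohodGraph W) : y.1 ∈ sobolevV K W := by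
  refine (Submodule.topologicalClosure_minimal _ (t := (sobolevV K W).comap
    (LinearMap.fst ℝ _ _)) (Submodule.span_le.2 ?_) ?_) hy
  · rintro y ⟨F, D, v, hF, h1, h2, -⟩
    have m1 := hF.isBddCyl.isCyl.memLp hW
    have m2 := hF.isBddCyl.memLp_grad
    refine Submodule.le_topologicalClosure _ (Submodule.subset_span ⟨(m1.toLp, m2.toLp),
      mem_smoothPairs_iff.2 ⟨F, D, hF, m1.coeFn_toLp, m2.coeFn_toLp⟩, v, ?_, ?_⟩)
    · filter_upwards [h1, m1.coeFn_toLp] with ω h h'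
      rw [LinearMap.fst_apply, h, h']
    · filter_upwards [h2, m2.coeFn_toLp] with ω h h'
      rw [LinearMap.fst_apply, h, h']
  · exact (Submodule.isClosed_topologicalClosure _).preimage continuous_fst

theorem skorohod_eq_of_mem_skorohodGraph [IsProbabilityMeasure P] (hW : IsIsonormal W)
    {x : WithLp 2 (Lp K 2 P × Lp (HilbertTensor K K) 2 P)} {X : Lp ℝ 2 P}
    (h : (x, X) ∈ skorohodGraph W) : x.fst ∈ skorohodDom W ∧ skorohod W x.fst = X := by
  have h := isSkorohod_of_mem_skorohodGraph hW h
  have hd : x.fst ∈ skorohodDom W := ⟨_, h⟩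
  exact ⟨hd, (isSkorohod_skorohod hd).unique h⟩

theorem sum_mem_skorohodGraph {x : ℕ → WithLp 2 (Lp K 2 P × Lp (HilbertTensor K K) 2 P)}
    {X : ℕ → Lp ℝ 2 P} (h : ∀ k, (x k, X k) ∈ skorohodGraph W) (s : Finset ℕ) :
    (∑ k ∈ s, x k, ∑ k ∈ s, X k) ∈ skorohodGraph W := by
  have h1 : (∑ k ∈ s, x k, ∑ k ∈ s, X k) = ∑ k ∈ s, (x k, X k) :=
    Prod.ext (by rw [Prod.fst_sum]) (by rw [Prod.snd_sum])
  rw [h1]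
  exact Submodule.sum_mem _ fun k _ => h k

/-- The Skorohod integral of a convergent series is the series of the Skorohod integrals. -/
theorem tendsto_sum_skorohod [IsProbabilityMeasure P] [CompleteSpace K] (hW : IsIsonormal W)
    {x : ℕ → WithLp 2 (Lp K 2 P × Lp (HilbertTensor K K) 2 P)} {X : ℕ → Lp ℝ 2 P}
    (h : ∀ k, (x k, X k) ∈ skorohodGraph W)
    {y : WithLp 2 (Lp K 2 P × Lp (HilbertTensor K K) 2 P)} (hy : HasSum x y) :
    y ∈ sobolevV K W ∧ y.fst ∈ skorohodDom W ∧
      Tendsto (fun N => ∑ k ∈ Finset.range N, X k) atTop (𝓝 (skorohod W y.fst)) := by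
  have hG := fun N => sum_mem_skorohodGraph h (Finset.range N)
  have htend := hy.tendsto_sum_nat
  have hx := fun N => fst_mem_sobolevV_of_mem_skorohodGraph hW (hG N)
  have hyS : y ∈ sobolevV K W :=
    (Submodule.isClosed_topologicalClosure _).mem_of_tendsto htend
      (Eventually.of_forall hx)
  obtain ⟨Y, hY⟩ := exists_mem_skorohodGraph hW hyS
  obtain ⟨h1, h2⟩ := skorohod_eq_of_mem_skorohodGraph hW hY
  refine ⟨hyS, h1, ?_⟩
  rw [h2, tendsto_iff_norm_sub_tendsto_zero]
  refine squeeze_zero (fun N => norm_nonneg _) (fun N => ?_)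
    (tendsto_iff_norm_sub_tendsto_zero.1 htend)
  -- The graph is a subspace, so the norm bound applies to the difference between a partial sum and
  -- the limit.
  have h3 := norm_snd_le_of_mem_skorohodGraph hW ((skorohodGraph W).sub_mem (hG N) hY)
  rwa [Prod.mk_sub_mk] at h3

end

theorem inner_compLpL {E F : Type*} [NormedAddCommGroup E] [InnerProductSpace ℝ E]
    [NormedAddCommGroup F] [InnerProductSpace ℝ F] {L M : E →L[ℝ] F} {c : ℝ}
    (h : ∀ x y, inner ℝ (L x) (M y) = c * (inner ℝ x y : ℝ)) (f g : Lp E 2 P) :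
    inner ℝ (L.compLpL 2 P f) (M.compLpL 2 P g) = c * (inner ℝ f g : ℝ) := by
  rw [L2.inner_def, L2.inner_def, ← integral_const_mul]
  refine integral_congr_ae ?_
  filter_upwards [L.coeFn_compLpL (p := 2) (μ := P) f, M.coeFn_compLpL (p := 2) (μ := P) g]
    with ω h1 h2
  rw [h1, h2, h]

/-! ### Multiplication of Sobolev pairs by a vector of V. -/

variable {H : HurstIndex} {T : ℝ}
variable {V : Type*} [NormedAddCommGroup V] [InnerProductSpace ℝ V] [CompleteSpace V]

theorem timesVecTensor_coe (H : HurstIndex) (T : ℝ) (v : V)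
    (x : FracSpace H T ℝ ⊗[ℝ] FracSpace H T ℝ) :
    timesVecTensor H T v (x : HilbertTensor (FracSpace H T ℝ) (FracSpace H T ℝ)) =
      ((TensorProduct.mapL (timesVec H T v) (timesVec H T v) x :
        FracSpace H T V ⊗[ℝ] FracSpace H T V) : HilbertTensor (FracSpace H T V) (FracSpace H T V)) :=
  ContinuousLinearMap.completion_apply_coe _ _

theorem timesVecTensor_tmul (H : HurstIndex) (T : ℝ) (v : V) (φ ψ : FracSpace H T ℝ) :
    timesVecTensor H T v ((φ ⊗ₜ[ℝ] ψ : FracSpace H T ℝ ⊗[ℝ] FracSpace H T ℝ) :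
      HilbertTensor (FracSpace H T ℝ) (FracSpace H T ℝ)) =
      ((timesVec H T v φ ⊗ₜ[ℝ] timesVec H T v ψ : FracSpace H T V ⊗[ℝ] FracSpace H T V) :
        HilbertTensor (FracSpace H T V) (FracSpace H T V)) := by
  rw [timesVecTensor_coe]
  rfl

/-- Each tensor slot contributes one factor ⟨v, w⟩; density and bilinearity reduce the claim to
elementary tensors. -/
theorem inner_timesVecTensor (H : HurstIndex) (T : ℝ) (v w : V)
    (x y : HilbertTensor (FracSpace H T ℝ) (FracSpace H T ℝ)) :
    inner ℝ (timesVecTensor H T v x) (timesVecTensor H T w y) =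
      (inner ℝ v w * inner ℝ v w) * (inner ℝ x y : ℝ) := by
  induction x, y using Completion.induction_on₂ with
  | hp => exact isClosed_eq (by fun_prop) (by fun_prop)
  | ih x y =>
    induction x using TensorProduct.induction_on with
    | zero =>
      rw [Completion.coe_zero, map_zero, inner_zero_left, inner_zero_left, mul_zero]
    | add x x' hx hx' =>
      rw [Completion.coe_add, map_add, inner_add_left, inner_add_left, hx, hx']
      ring
    | tmul φ ψ =>
      induction y using TensorProduct.induction_on with
      | zero =>
        rw [Completion.coe_zero, map_zero, inner_zero_right, inner_zero_right, mul_zero]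
      | add y y' hy hy' =>
        rw [Completion.coe_add, map_add, inner_add_right, inner_add_right, hy, hy']
        ring
      | tmul φ' ψ' =>
        rw [timesVecTensor_tmul, timesVecTensor_tmul, Completion.inner_coe, Completion.inner_coe,
          TensorProduct.inner_tmul, TensorProduct.inner_tmul, inner_timesVec, inner_timesVec]
        ring

/-- The map `(u, D u) ↦ (u v, (D u) v ⊗ v)`. -/
noncomputable def pairTimes (P : Measure Ω) (H : HurstIndex) (T : ℝ) (v : V) :
    WithLp 2 (Lp (FracSpace H T ℝ) 2 P ×
      Lp (HilbertTensor (FracSpace H T ℝ) (FracSpace H T ℝ)) 2 P) →L[ℝ]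
    WithLp 2 (Lp (FracSpace H T V) 2 P ×
      Lp (HilbertTensor (FracSpace H T V) (FracSpace H T V)) 2 P) :=
  (WithLp.prodContinuousLinearEquiv 2 ℝ _ _).symm.toContinuousLinearMap.comp
    ((((timesVec H T v).compLpL 2 P).prodMap ((timesVecTensor H T v).compLpL 2 P)).comp
      (WithLp.prodContinuousLinearEquiv 2 ℝ _ _).toContinuousLinearMap)

theorem fst_pairTimes (v : V) (x : WithLp 2 (Lp (FracSpace H T ℝ) 2 P ×
      Lp (HilbertTensor (FracSpace H T ℝ) (FracSpace H T ℝ)) 2 P)) :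
    (pairTimes P H T v x).fst = (timesVec H T v).compLpL 2 P x.fst := rfl

theorem snd_pairTimes (v : V) (x : WithLp 2 (Lp (FracSpace H T ℝ) 2 P ×
      Lp (HilbertTensor (FracSpace H T ℝ) (FracSpace H T ℝ)) 2 P)) :
    (pairTimes P H T v x).snd = (timesVecTensor H T v).compLpL 2 P x.snd := rfl

theorem inner_pairTimes (v w : V) (x y : WithLp 2 (Lp (FracSpace H T ℝ) 2 P ×
      Lp (HilbertTensor (FracSpace H T ℝ) (FracSpace H T ℝ)) 2 P)) :
    inner ℝ (pairTimes P H T v x) (pairTimes P H T w y) =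
      inner ℝ v w * (inner ℝ x.fst y.fst : ℝ) +
      (inner ℝ v w * inner ℝ v w) * (inner ℝ x.snd y.snd : ℝ) := by
  rw [WithLp.prod_inner_apply]
  exact congrArg₂ _ (inner_compLpL (inner_timesVec H T v w) _ _)
    (inner_compLpL (inner_timesVecTensor H T v w) _ _)

/-- `pairTimes` as a linear isometry, for a unit vector `v`. -/
noncomputable def pairTimesIsometry (P : Measure Ω) (H : HurstIndex) (T : ℝ) (v : V)
    (hv : ‖v‖ = 1) :
    WithLp 2 (Lp (FracSpace H T ℝ) 2 P ×
      Lp (HilbertTensor (FracSpace H T ℝ) (FracSpace H T ℝ)) 2 P) →ₗᵢ[ℝ]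
    WithLp 2 (Lp (FracSpace H T V) 2 P ×
      Lp (HilbertTensor (FracSpace H T V) (FracSpace H T V)) 2 P) where
  toLinearMap := (pairTimes P H T v).toLinearMap
  norm_map' x := by
    change ‖pairTimes P H T v x‖ = ‖x‖
    rw [← sq_eq_sq₀ (norm_nonneg _) (norm_nonneg _), ← real_inner_self_eq_norm_sq,
      inner_pairTimes, real_inner_self_eq_norm_sq v, hv, WithLp.prod_norm_sq_eq_of_L2,
      real_inner_self_eq_norm_sq, real_inner_self_eq_norm_sq]
    simp

/-- Both components carry a factor ⟨eⱼ, eₖ⟩ = 0. Convergence of the series and the norm identity of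
the theorem come from here. -/
theorem orthogonalFamily_pairTimes (P : Measure Ω) (H : HurstIndex) (T : ℝ)
    (e : HilbertBasis ℕ ℝ V) :
    OrthogonalFamily ℝ (fun _ : ℕ => WithLp 2 (Lp (FracSpace H T ℝ) 2 P ×
      Lp (HilbertTensor (FracSpace H T ℝ) (FracSpace H T ℝ)) 2 P))
      fun k => pairTimesIsometry P H T (e k) (norm_hilbertBasis e k) := by
  intro j k hjk x y
  refine (inner_pairTimes (e j) (e k) x y).trans ?_
  rw [e.orthonormal.2 hjk]
  simp

variable {β : ℕ → Set.Icc (0 : ℝ) T → Ω → ℝ}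

theorem map_gradComb {K K' : Type*} [NormedAddCommGroup K] [InnerProductSpace ℝ K]
    [NormedAddCommGroup K'] [InnerProductSpace ℝ K'] (J : K →L[ℝ] K') {ι : Type*} [Fintype ι]
    [DecidableEq ι] (φ : ι → K) (L : (ι → ℝ) →L[ℝ] ℝ) :
    J (gradComb φ L) = gradComb (fun i => J (φ i)) L := by
  simp [gradComb]

/-- The same f serves, with each φᵢ replaced by φᵢ eₖ; the gradient follows by linearity. -/
theorem IsSmoothCyl.jointProcess (e : HilbertBasis ℕ ℝ V) (hβ : ∀ k, IsFBM H T (β k) P) {k : ℕ}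
    {F : Ω → ℝ} {D : Ω → FracSpace H T ℝ} (h : IsSmoothCyl (wiener (hβ k)) F D) :
    IsSmoothCyl (FracMalliavin.jointProcess e hβ) F fun ω => timesVec H T (e k) (D ω) := by
  obtain ⟨n, f, φ, hn, hf, rfl, rfl⟩ := h
  refine ⟨n, f, fun i => timesVec H T (e k) (φ i), hn, hf, ?_, ?_⟩
  · simp only [jointProcess_timesVec]
  · simp only [jointProcess_timesVec, map_gradComb]

/-- On generators F W(v) − ⟨DF, v⟩ does not change, since B(v eₖ) = βᵏ(v) and ⟨(DF) eₖ, v eₖ⟩ = ⟨DF,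
v⟩ for the unit vector eₖ. Hence u and u eₖ have the same Skorohod integral. -/
theorem pairTimes_mem_skorohodGraph (e : HilbertBasis ℕ ℝ V) (hβ : ∀ k, IsFBM H T (β k) P) (k : ℕ)
    {x : WithLp 2 (Lp (FracSpace H T ℝ) 2 P ×
      Lp (HilbertTensor (FracSpace H T ℝ) (FracSpace H T ℝ)) 2 P)} {X : Lp ℝ 2 P}
    (h : (x, X) ∈ skorohodGraph (wiener (hβ k))) :
    (pairTimes P H T (e k) x, X) ∈ skorohodGraph (jointProcess e hβ) := by
  set J := (pairTimes P H T (e k)).prodMap (ContinuousLinearMap.id ℝ (Lp ℝ 2 P)) with hJ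
  refine (Submodule.topologicalClosure_minimal _ (t := (skorohodGraph (jointProcess e hβ)).comap
    J.toLinearMap) (Submodule.span_le.2 ?_) ?_) h
  · rintro y ⟨F, D, v, hF, h1, h2, h3⟩
    refine Submodule.le_topologicalClosure _ (Submodule.subset_span
      ⟨F, _, timesVec H T (e k) v, hF.jointProcess e hβ, ?_, ?_, ?_⟩)
    · change (pairTimes P H T (e k) y.1).fst =ᵐ[P] _
      rw [fst_pairTimes]
      filter_upwards [(timesVec H T (e k)).coeFn_compLpL (p := 2) (μ := P) y.1.fst, h1] with ω h h'
      rw [h, h', map_smul]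
    · change (pairTimes P H T (e k) y.1).snd =ᵐ[P] _
      rw [snd_pairTimes]
      filter_upwards [(timesVecTensor H T (e k)).coeFn_compLpL (p := 2) (μ := P) y.1.snd, h2]
        with ω h h'
      rw [h, h', timesVecTensor_tmul]
    · change y.2 =ᵐ[P] _
      simp only [jointProcess_timesVec, inner_timesVec, real_inner_self_eq_norm_sq,
        norm_hilbertBasis, one_pow, one_mul]
      exact h3
  · exact (Submodule.isClosed_topologicalClosure _).preimage J.continuous

end

end FracMalliavin

/-! ### Proof of the theorem. -/

open FracMalliavin
theorem mainTheorem7 {Ω : Type*} [MeasurableSpace Ω] (P : Measure Ω) [IsProbabilityMeasure P]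
    {V : Type*} [NormedAddCommGroup V] [InnerProductSpace ℝ V] [CompleteSpace V]
    (e : HilbertBasis ℕ ℝ V) (H : HurstIndex) (T : ℝ) (hT : 0 < T)
    (β : ℕ → Set.Icc (0 : ℝ) T → Ω → ℝ) (hβ : ∀ k, IsFBM H T (β k) P)
    (hindep : iIndepFun (fun k ω t => β k t ω) P)
    (u : ∀ k, sobolevV (FracSpace H T ℝ) (wiener (hβ k)))
    (hu : Summable fun k => ‖u k‖ ^ 2) :
    let B : FracSpace H T V → Lp ℝ 2 P := jointProcess e hβ
    let ue : ℕ → Lp (FracSpace H T V) 2 P := fun k =>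
      (timesVec H T (e k)).compLpL 2 P (u k).1.fst
    let Due : ℕ → Lp (HilbertTensor (FracSpace H T V) (FracSpace H T V)) 2 P := fun k =>
      (timesVecTensor H T (e k)).compLpL 2 P (u k).1.snd
    ∃ (UN : ℕ → sobolevV (FracSpace H T V) B) (U : sobolevV (FracSpace H T V) B),
      (∀ N, (UN N).1.fst = ∑ k ∈ Finset.range N, ue k) ∧
      (∀ N, (UN N).1.snd = ∑ k ∈ Finset.range N, Due k) ∧
      Tendsto (fun N => ‖UN N - U‖) atTop (𝓝 0) ∧
      Tendsto (fun N => ∑ k ∈ Finset.range N, ue k) atTop (𝓝 U.1.fst) ∧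
      Tendsto (fun N => ∑ k ∈ Finset.range N, Due k) atTop (𝓝 U.1.snd) ∧
      ‖U‖ ^ 2 = ∑' k, ‖u k‖ ^ 2 ∧
      (∀ k, (u k).1.fst ∈ skorohodDom (wiener (hβ k))) ∧
      U.1.fst ∈ skorohodDom B ∧
      Tendsto (fun N => ∑ k ∈ Finset.range N, skorohod (wiener (hβ k)) (u k).1.fst) atTop
        (𝓝 (skorohod B U.1.fst)) := by
  intro B ue Due
  have hW := isIsonormal_wiener hβ hindep
  have hB : IsIsonormal B := isIsonormal_jointProcess e hβ hindep
  have horth := orthogonalFamily_pairTimes P H T e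
  -- X k is the Skorohod integral of u k with respect to βᵏ, as `hsk` confirms; by `hJX` it is also
  -- that of u k times eₖ with respect to B.
  choose X hX using fun k => exists_mem_skorohodGraph (hW k) (u k).2
  have hsk := fun k => skorohod_eq_of_mem_skorohodGraph (hW k) (hX k)
  have hJX := fun k => pairTimes_mem_skorohodGraph e hβ k (hX k)
  -- An orthogonal series in a complete space converges exactly when the squared norms are summable.
  obtain ⟨y, hy⟩ : Summable fun k => pairTimes P H T (e k) (u k).1 :=
    (horth.summable_iff_norm_sq_summable fun k => (u k).1).2 hu
  obtain ⟨hyS, hyD, hyT⟩ := tendsto_sum_skorohod hB hJX hy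
  have htend := hy.tendsto_sum_nat
  have hfst : ∀ N, (∑ k ∈ Finset.range N, pairTimes P H T (e k) (u k).1).fst =
      ∑ k ∈ Finset.range N, ue k := fun N =>
    map_sum (WithLp.fstL 2 ℝ (Lp (FracSpace H T V) 2 P)
      (Lp (HilbertTensor (FracSpace H T V) (FracSpace H T V)) 2 P)) _ (Finset.range N)
  have hsnd : ∀ N, (∑ k ∈ Finset.range N, pairTimes P H T (e k) (u k).1).snd =
      ∑ k ∈ Finset.range N, Due k := fun N =>
    map_sum (WithLp.sndL 2 ℝ (Lp (FracSpace H T V) 2 P)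
      (Lp (HilbertTensor (FracSpace H T V) (FracSpace H T V)) 2 P)) _ (Finset.range N)
  have hnorm : ‖y‖ ^ 2 = ∑' k, ‖u k‖ ^ 2 := by
    -- Pythagoras for the partial sums; the identity for y follows in the limit.
    have h2 : ∀ N, ‖∑ k ∈ Finset.range N, pairTimes P H T (e k) (u k).1‖ ^ 2 =
        ∑ k ∈ Finset.range N, ‖u k‖ ^ 2 := fun N =>
      horth.norm_sum (fun k => (u k).1) (Finset.range N)
    exact tendsto_nhds_unique ((htend.norm.pow 2).congr h2) hu.hasSum.tendsto_sum_nat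
  have hf : Tendsto (fun N => ∑ k ∈ Finset.range N, ue k) atTop (𝓝 y.fst) :=
    (((WithLp.fstL 2 ℝ (Lp (FracSpace H T V) 2 P)
      (Lp (HilbertTensor (FracSpace H T V) (FracSpace H T V)) 2 P)).continuous.tendsto y).comp
        htend).congr hfst
  have hs : Tendsto (fun N => ∑ k ∈ Finset.range N, Due k) atTop (𝓝 y.snd) :=
    (((WithLp.sndL 2 ℝ (Lp (FracSpace H T V) 2 P)
      (Lp (HilbertTensor (FracSpace H T V) (FracSpace H T V)) 2 P)).continuous.tendsto y).comp
        htend).congr hsnd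
  have hδ : Tendsto (fun N => ∑ k ∈ Finset.range N, skorohod (wiener (hβ k)) (u k).1.fst) atTop
      (𝓝 (skorohod B y.fst)) :=
    hyT.congr fun N => Finset.sum_congr rfl fun k _ => (hsk k).2.symm
  have hn := tendsto_iff_norm_sub_tendsto_zero.1 htend
  exact ⟨fun N => ⟨_, fst_mem_sobolevV_of_mem_skorohodGraph hB
    (sum_mem_skorohodGraph hJX (Finset.range N))⟩, ⟨y, hyS⟩, hfst, hsnd,
    hn, hf, hs, hnorm, fun k => (hsk k).1, hyD, hδ⟩
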